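/- Let $k+1>3$ and let $M$ be a smooth manifold of dimension $k+1$ with a $GL(2)$-structure, i.e. a rank-2 real vector bundle $E\to M$ together with a smooth isomorphism of vector bundles $TM\simeq S^k(E)$. Every basis $(x,y)$ of a fibre $E_p$ gives a frame $\chi=(x^k,x^{k-1}y,\ldots,xy^{k-1},y^k)$ of $T_pM$; these frames are called adapted and form the bundle $B(E)$. Let $\mathfrak g_k\subset\mathfrak{gl}(k+1,\mathbb R)$ be the image of $\mathfrak{gl}(2,\mathbb R)$ under its standard representation on homogeneous polynomials of degree $k$ in $(x,y)$, written in the basis $x^k,x^{k-1}y,\ldots,y^k$, and let $$\mathfrak g_k^\perp=\{\psi\in\mathfrak{gl}(k+1,\mathbb R)\ :\ \operatorname{tr}(\eta\psi)=0\ \text{ for all }\eta\in\mathfrak g_k\}.$$ A $GL(2)$-connection is a smooth linear connection on $M$ preserving $B(E)$, i.e. one whose connection form in every smooth local adapted frame is the $\mathfrak g_k$-valued form $\Phi$ corresponding to a $\mathfrak{gl}(2,\mathbb R)$-valued 1-form $\phi=(\phi^i_j)$. Then there exists a unique $GL(2)$-connection whose torsion $\Theta$ satisfies $\Theta_\chi(X,\cdot)\in\mathfrak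 g_k^\perp$ for every adapted frame $\chi$ at every point $p\in M$ and every $X\in T_pM$, where $\Theta_\chi(X,\cdot)$ denotes the matrix of the endomorphism $Y\mapsto\Theta(X,Y)$ of $T_pM$ in the frame $\chi$. -/

import Mathlib

open Bundle Set
open scoped Manifold ContDiff

noncomputable section

namespace GL2

/-- The irreducible representation of `𝔤𝔩(2)` on the homogeneous polynomials of degree `k` in
`(x, y)`, as matrices in the basis `x ^ k, x ^ (k-1) y, …, y ^ k`: the substitution
`x ↦ g₀₀ x + g₁₀ y`, `y ↦ g₀₁ x + g₁₁ y` acting as a derivation, so that the `j`-th column is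
`x ^ (k-j) y ^ j ↦ j g₀₁ x ^ (k-j+1) y ^ (j-1) + ((k-j) g₀₀ + j g₁₁) x ^ (k-j) y ^ j
  + (k-j) g₁₀ x ^ (k-j-1) y ^ (j+1)`. -/
def rep (k : ℕ) :
    Matrix (Fin 2) (Fin 2) ℝ →ₗ[ℝ] Matrix (Fin (k + 1)) (Fin (k + 1)) ℝ where
  toFun g := Matrix.of fun i j =>
    if (i : ℕ) = j then ((k : ℝ) - (j : ℕ)) * g 0 0 + ((j : ℕ) : ℝ) * g 1 1
    else if (i : ℕ) + 1 = j then ((j : ℕ) : ℝ) * g 0 1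
    else if (i : ℕ) = j + 1 then ((k : ℝ) - (j : ℕ)) * g 1 0
    else 0
  map_add' g h := by
    ext i j
    simp only [Matrix.of_apply, Matrix.add_apply]
    split_ifs <;> ring
  map_smul' c g := by
    ext i j
    simp only [Matrix.of_apply, Matrix.smul_apply, smul_eq_mul, RingHom.id_apply]
    split_ifs <;> ring

/-- The subspace `𝔤_k` of `(k+1) × (k+1)` matrices, the image of `𝔤𝔩(2)`. -/
def gk (k : ℕ) : Submodule ℝ (Matrix (Fin (k + 1)) (Fin (k + 1)) ℝ) :=
  LinearMap.range (rep k)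

/-- The trace-orthogonal complement `𝔤_k^⊥ = {ψ | tr (η ∘ ψ) = 0 for all η ∈ 𝔤_k}`. -/
def gkPerp (k : ℕ) : Submodule ℝ (Matrix (Fin (k + 1)) (Fin (k + 1)) ℝ) where
  carrier := {ψ | ∀ η ∈ gk k, (η * ψ).trace = 0}
  add_mem' {a b} ha hb η hη := by
    rw [Matrix.mul_add, Matrix.trace_add, ha η hη, hb η hη, add_zero]
  zero_mem' η _ := by simp
  smul_mem' c a ha η hη := by
    rw [Matrix.mul_smul, Matrix.trace_smul, ha η hη, smul_zero]

section Structure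

variable (k : ℕ) (M : Type*) [TopologicalSpace M]
  [ChartedSpace (EuclideanSpace ℝ (Fin (k + 1))) M] [IsManifold (𝓡 (k + 1)) ∞ M]
  (F : Type*) [NormedAddCommGroup F] [NormedSpace ℝ F]
  (E : M → Type*) [TopologicalSpace (TotalSpace F E)]
  [∀ p, AddCommGroup (E p)] [∀ p, Module ℝ (E p)] [∀ p, TopologicalSpace (E p)]
  [FiberBundle F E] [VectorBundle ℝ F E] [ContMDiffVectorBundle ∞ F E (𝓡 (k + 1))]

/-- A smooth isomorphism of vector bundles `S^k(E) ≃ TM` over the identity of a `(k+1)`-manifold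
`M`. Smoothness: products of smooth local sections of `E` are sent to smooth local vector fields
(such products contain local frames of `S^k(E)`). -/
structure GL2Structure where
  /-- The isomorphism on the fibres. -/
  iso : ∀ p : M, SymmetricPower ℝ (Fin k) (E p) ≃ₗ[ℝ] TangentSpace (𝓡 (k + 1)) p
  smooth : ∀ (U : Set M), IsOpen U → ∀ s : Fin k → (p : M) → E p,
    (∀ i, ContMDiffOn (𝓡 (k + 1)) ((𝓡 (k + 1)).prod 𝓘(ℝ, F)) ∞
      (fun p => (⟨p, s i p⟩ : TotalSpace F E)) U) →
    ContMDiffOn (𝓡 (k + 1)) (𝓡 (k + 1)).tangent ∞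
      (fun p => (⟨p, iso p (SymmetricPower.tprod ℝ fun i => s i p)⟩ :
        TangentBundle (𝓡 (k + 1)) M)) U

variable {k M F E}

/-- The frame `χ = (x ^ k, x ^ (k-1) y, …, y ^ k)` of `T_p M` given by vectors
`(x, y) = (u 0, u 1)` of `E_p`. When `(x, y)` runs through the bases of `E_p`, these are the
points of the bundle of adapted frames `B(E)` over `p`. -/
def GL2Structure.frame (S : GL2Structure k M F E) (p : M) (u : Fin 2 → E p) (j : Fin (k + 1)) :
    TangentSpace (𝓡 (k + 1)) p :=
  S.iso p (SymmetricPower.tprod ℝ fun i : Fin k => if (i : ℕ) + j < k then u 0 else u 1)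

/-- `cov` is a `GL(2)`-connection: a smooth linear connection that preserves the bundle of adapted
frames, i.e. whose connection form in every smooth local adapted frame `χ` is `𝔤_k`-valued,
`∇ χ_j = ∑ i, Φ^i_j χ_i` with `Φ` the image of a `𝔤𝔩(2)`-valued `1`-form `φ`. -/
structure GL2Structure.IsGL2Connection (S : GL2Structure k M F E)
    (cov : CovariantDerivative (𝓡 (k + 1)) (EuclideanSpace ℝ (Fin (k + 1)))
      (TangentSpace (𝓡 (k + 1)) : M → Type _)) : Prop where
  smooth : CovariantDerivative.ContMDiffCovariantDerivative cov ∞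
  adapted : ∀ (U : Set M), IsOpen U → ∀ e : Fin 2 → (p : M) → E p,
    IsLocalFrameOn (𝓡 (k + 1)) F ∞ e U →
    ∃ φ : (p : M) → TangentSpace (𝓡 (k + 1)) p →ₗ[ℝ] Matrix (Fin 2) (Fin 2) ℝ,
      ∀ p ∈ U, ∀ (X : TangentSpace (𝓡 (k + 1)) p) (j : Fin (k + 1)),
        cov (fun q => S.frame q (fun a => e a q) j) p X =
          ∑ i, rep k (φ p X) i j • S.frame p (fun a => e a p) i

/-- The torsion `Θ` of `cov` satisfies `Θ_χ(X, ·) ∈ 𝔤_k^⊥` for every adapted frame `χ` and every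
tangent vector `X`: the matrix `ψ` of `Y ↦ Θ(X, Y)` in the frame `χ` belongs to `𝔤_k^⊥`. -/
def GL2Structure.HasNormalizedTorsion (S : GL2Structure k M F E)
    (cov : CovariantDerivative (𝓡 (k + 1)) (EuclideanSpace ℝ (Fin (k + 1)))
      (TangentSpace (𝓡 (k + 1)) : M → Type _)) : Prop :=
  ∀ (p : M) (u : Module.Basis (Fin 2) ℝ (E p)) (X : TangentSpace (𝓡 (k + 1)) p),
    ∃ ψ ∈ gkPerp k, ∀ j : Fin (k + 1),
      cov.torsion p X (S.frame p u j) = ∑ i, ψ i j • S.frame p u i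

end Structure

end GL2

end

/-! In an adapted frame `χ` coming from a local frame of `E`, a `GL(2)`-connection is a
`𝔤𝔩(2)`-valued form `φ`, that is, `k + 1` matrices `φ (χ m)` at each point. The torsion endomorphism
of `χ l` then has matrix `torsionPart φ l` minus the structure functions of the frame
(`HasFormAt.toMatrix_torsion`). Requiring this to lie in `𝔤_k^⊥` is a square inhomogeneous linear
system for `φ`: `4 (k + 1)` equations in `4 (k + 1)` unknowns.

The system is uniquely solvable as soon as its homogeneous part has trivial kernel
(`torsionPart_injective`). The diagonal torus of `GL(2)` splits it into weight blocks with at most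
four unknowns, and `weight_system_eq_zero` solves a block. Its nondegeneracy condition holds for `k
≥ 3` and fails for `k = 1, 2`. The solution `s` is linear in the structure functions
(`exists_normalizing`), so it is smooth where they are.

Two facts make the local solutions global. Trace orthogonality to `𝔤_k` does not depend on the
adapted frame, because `𝔤_k` consists of the derivation extensions of endomorphisms of the fibre of
`E` (`toMatrix_mem_gkPerp_iff`). Having a `𝔤𝔩(2)`-valued form does not depend on the frame of `E`
either (`HasFormAt.exists_of_frame`). Hence one may choose at each point any local frame and use its
local solution there (`globalCov`). Pointwise uniqueness (`HasFormAt.eq_localCov`) shows that nearby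
choices agree, which gives smoothness, and it also proves the uniqueness claim. -/

noncomputable section

namespace GL2

/-! ### Linear algebra of the normalization condition. -/

section Algebra

variable {k : ℕ}

lemma rep_apply (g : Matrix (Fin 2) (Fin 2) ℝ) (i j : Fin (k + 1)) :
    rep k g i j = if (i : ℕ) = j then ((k : ℝ) - (j : ℕ)) * g 0 0 + ((j : ℕ) : ℝ) * g 1 1
    else if (i : ℕ) + 1 = j then ((j : ℕ) : ℝ) * g 0 1
    else if (i : ℕ) = j + 1 then ((k : ℝ) - (j : ℕ)) * g 1 0
    else 0 := rfl

/-- Contraction of a column of the representation, with a matrix depending on the row. -/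
lemma sum_rep_smul {V : Type*} [AddCommGroup V] [Module ℝ V] (v : ℕ → V)
    (ψ : ℕ → Matrix (Fin 2) (Fin 2) ℝ) (l : Fin (k + 1)) :
    ∑ j : Fin (k + 1), rep k (ψ j) j l • v j =
      (((k : ℝ) - (l : ℕ)) * ψ l 0 0 + ((l : ℕ) : ℝ) * ψ l 1 1) • v l +
      (((l : ℕ) : ℝ) * ψ (l - 1) 0 1) • v (l - 1) +
      (((k : ℝ) - (l : ℕ)) * ψ (l + 1) 1 0) • v (l + 1) := by
  obtain ⟨l, hl⟩ := l
  -- The neighbours `l - 1` (truncated at `l = 0`) and `l + 1` (out of range at `l = k`) need no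
  -- separate treatment: their coefficients `l` and `k - l` vanish exactly there.
  have hterm : ∀ j : ℕ, (if j = l then ((k : ℝ) - l) * ψ j 0 0 + (l : ℝ) * ψ j 1 1
      else if j + 1 = l then (l : ℝ) * ψ j 0 1
      else if j = l + 1 then ((k : ℝ) - l) * ψ j 1 0 else 0) • v j =
      (if j = l then (((k : ℝ) - l) * ψ l 0 0 + (l : ℝ) * ψ l 1 1) • v l else 0) +
      (if j = l - 1 then ((l : ℝ) * ψ (l - 1) 0 1) • v (l - 1) else 0) +
      (if j = l + 1 then (((k : ℝ) - l) * ψ (l + 1) 1 0) • v (l + 1) else 0) := by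
    intro j
    rcases Nat.lt_trichotomy j l with h | h | h
    · by_cases h1 : j + 1 = l
      · subst h1
        have : j ≠ j + 1 + 1 := by omega
        simp [this]
      · have h2 : j ≠ l - 1 := by omega
        have h3 : j ≠ l + 1 := by omega
        simp [h.ne, h1, h2, h3]
    · subst h
      rcases Nat.eq_zero_or_pos j with h | h
      · subst h; simp
      · have : j ≠ j - 1 := by omega
        simp [this]
    · have h2 : j ≠ l - 1 := by omega
      have h3 : j + 1 ≠ l := by omega
      by_cases h1 : j = l + 1
      · subst h1
        simp [h2, h3]
      · simp [h.ne', h1, h2, h3]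
  have := Fin.sum_univ_eq_sum_range (fun j =>
      (if j = l then (((k : ℝ) - l) * ψ l 0 0 + (l : ℝ) * ψ l 1 1) • v l else 0) +
      (if j = l - 1 then ((l : ℝ) * ψ (l - 1) 0 1) • v (l - 1) else 0) +
      (if j = l + 1 then (((k : ℝ) - l) * ψ (l + 1) 1 0) • v (l + 1) else 0)) (k + 1)
  simp only [rep_apply, hterm]
  rw [this]
  simp only [Finset.sum_add_distrib, Finset.sum_ite_eq', Finset.mem_range]
  have h1 : l - 1 < k + 1 := by omega
  simp only [hl, h1, if_true]
  by_cases h2 : l + 1 < k + 1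
  · simp [h2]
  · have : l = k := by omega
    simp [this]

lemma sum_mul_rep (a : ℕ → ℝ) (ψ : ℕ → Matrix (Fin 2) (Fin 2) ℝ) (l : Fin (k + 1)) :
    ∑ j : Fin (k + 1), a j * rep k (ψ j) j l =
      a l * (((k : ℝ) - (l : ℕ)) * ψ l 0 0 + ((l : ℕ) : ℝ) * ψ l 1 1) +
      ((l : ℕ) : ℝ) * (a (l - 1) * ψ (l - 1) 0 1) +
      ((k : ℝ) - (l : ℕ)) * (a (l + 1) * ψ (l + 1) 1 0) := by
  have := sum_rep_smul a ψ l
  simp only [smul_eq_mul] at this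
  simp only [mul_comm (a _)]
  rw [this]
  ring

lemma sum_range_sq (k : ℕ) :
    ∑ j ∈ Finset.range (k + 1), ((j : ℝ)) ^ 2 = k * (k + 1) * (2 * k + 1) / 6 := by
  induction k with
  | zero => simp
  | succ n ih => rw [Finset.sum_range_succ, ih]; push_cast; ring

lemma sum_range_id_real (k : ℕ) :
    ∑ j ∈ Finset.range (k + 1), (j : ℝ) = k * (k + 1) / 2 := by
  induction k with
  | zero => simp
  | succ n ih => rw [Finset.sum_range_succ, ih]; push_cast; ring

/-- The trace form of the representation. -/
lemma trace_rep_mul_rep (η g : Matrix (Fin 2) (Fin 2) ℝ) :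
    (rep k η * rep k g).trace =
      (k * (k + 1) * (2 * k + 1) / 6 : ℝ) * (η 0 0 * g 0 0 + η 1 1 * g 1 1) +
      (k * (k + 1) * (k - 1) / 6 : ℝ) * (η 0 0 * g 1 1 + η 1 1 * g 0 0) +
      (k * (k + 1) * (k + 2) / 6 : ℝ) * (η 0 1 * g 1 0 + η 1 0 * g 0 1) := by
  have h1 : ∀ j : Fin (k + 1), ∑ i, rep k g j i * rep k η i j =
      (((k : ℝ) - (j : ℕ)) * g 0 0 + ((j : ℕ) : ℝ) * g 1 1) *
        (((k : ℝ) - (j : ℕ)) * η 0 0 + ((j : ℕ) : ℝ) * η 1 1) +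
      ((j : ℕ) : ℝ) * ((k : ℝ) - (j : ℕ) + 1) * (g 1 0 * η 0 1) +
      ((k : ℝ) - (j : ℕ)) * ((j : ℕ) + 1) * (g 0 1 * η 1 0) := by
    intro j
    have := sum_mul_rep (k := k) (fun i => if (j : ℕ) = i then ((k : ℝ) - i) * g 0 0 + (i : ℝ) * g 1 1
      else if (j : ℕ) + 1 = i then (i : ℝ) * g 0 1
      else if (j : ℕ) = i + 1 then ((k : ℝ) - i) * g 1 0
      else 0) (fun _ => η) j
    simp only [← rep_apply] at this
    rw [this]
    simp only [if_true]
    rcases Nat.eq_zero_or_pos (j : ℕ) with h | h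
    · simp [h]
    · have e1 : (j : ℕ) ≠ j - 1 := by omega
      have e2 : (j : ℕ) + 1 ≠ j - 1 := by omega
      have e3 : (j : ℕ) = j - 1 + 1 := by omega
      have e4 : (((j : ℕ) - 1 : ℕ) : ℝ) = (j : ℕ) - 1 := by
        rw [Nat.cast_sub (by omega)]; simp
      simp only [e1, e2, ← e3, if_true, if_false, e4]
      simp
      ring
  rw [Matrix.trace_mul_comm, Matrix.trace]
  simp only [Matrix.diag_apply, Matrix.mul_apply, h1]
  rw [Fin.sum_univ_eq_sum_range (fun j : ℕ => (((k : ℝ) - j) * g 0 0 + (j : ℝ) * g 1 1) *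
        (((k : ℝ) - j) * η 0 0 + (j : ℝ) * η 1 1) +
      (j : ℝ) * ((k : ℝ) - j + 1) * (g 1 0 * η 0 1) +
      ((k : ℝ) - j) * (j + 1) * (g 0 1 * η 1 0)) (k + 1)]
  have h2 : ∀ j : ℕ, (((k : ℝ) - j) * g 0 0 + (j : ℝ) * g 1 1) *
        (((k : ℝ) - j) * η 0 0 + (j : ℝ) * η 1 1) +
      (j : ℝ) * ((k : ℝ) - j + 1) * (g 1 0 * η 0 1) +
      ((k : ℝ) - j) * (j + 1) * (g 0 1 * η 1 0) =
      (j : ℝ) ^ 2 * ((g 0 0 - g 1 1) * (η 0 0 - η 1 1) - g 1 0 * η 0 1 - g 0 1 * η 1 0) +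
      (j : ℝ) * (k * (g 1 1 - g 0 0) * η 0 0 + k * g 0 0 * (η 1 1 - η 0 0)
        + (k + 1) * (g 1 0 * η 0 1) + (k - 1) * (g 0 1 * η 1 0)) +
      (k ^ 2 * (g 0 0 * η 0 0) + k * (g 0 1 * η 1 0)) := by
    intro j; ring
  simp only [h2]
  rw [Finset.sum_add_distrib, Finset.sum_add_distrib, ← Finset.sum_mul, ← Finset.sum_mul,
    sum_range_sq, sum_range_id_real]
  simp
  ring

/-- The contribution to the torsion of a connection form `φ` with values in `𝔤𝔩(2)`: the matrix
of `Y ↦ Φ(χ_l) Y - Φ(Y) χ_l`. -/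
def torsionPart (φ : Fin (k + 1) → Matrix (Fin 2) (Fin 2) ℝ) (l : Fin (k + 1)) :
    Matrix (Fin (k + 1)) (Fin (k + 1)) ℝ :=
  Matrix.of fun i j => rep k (φ l) i j - rep k (φ j) i l

lemma trace_rep_mul_contraction (η : Matrix (Fin 2) (Fin 2) ℝ)
    (φ : ℕ → Matrix (Fin 2) (Fin 2) ℝ) (l : Fin (k + 1)) :
    (rep k η * Matrix.of fun i j : Fin (k + 1) => rep k (φ j) i l).trace =
      η 0 0 * (((k : ℝ) - (l : ℕ)) * (((k : ℝ) - (l : ℕ)) * φ l 0 0 + (l : ℕ) * φ l 1 1) +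
        (l : ℕ) * (k - (l : ℕ) + 1) * φ (l - 1) 0 1 +
        (k - (l : ℕ)) * (k - (l : ℕ) - 1) * φ (l + 1) 1 0) +
      η 1 1 * ((l : ℕ) * (((k : ℝ) - (l : ℕ)) * φ l 0 0 + (l : ℕ) * φ l 1 1) +
        (l : ℕ) * ((l : ℕ) - 1) * φ (l - 1) 0 1 +
        (k - (l : ℕ)) * ((l : ℕ) + 1) * φ (l + 1) 1 0) +
      η 0 1 * ((l : ℕ) * ((k - (l : ℕ)) * φ (l - 1) 0 0 + (l : ℕ) * φ (l - 1) 1 1) +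
        (l : ℕ) * ((l : ℕ) - 1) * φ (l - 2) 0 1 +
        (k - (l : ℕ)) * ((l : ℕ) + 1) * φ l 1 0) +
      η 1 0 * ((k - (l : ℕ)) * ((k - (l : ℕ)) * φ (l + 1) 0 0 + (l : ℕ) * φ (l + 1) 1 1) +
        (l : ℕ) * (k - (l : ℕ) + 1) * φ l 0 1 +
        (k - (l : ℕ)) * (k - (l : ℕ) - 1) * φ (l + 2) 1 0) := by
  have h1 : ∀ j : Fin (k + 1), ∑ i : Fin (k + 1), rep k (φ i) j l * rep k η i j =
      ((k - (j : ℕ)) * η 0 0 + (j : ℕ) * η 1 1) * rep k (φ j) j l +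
      ((j : ℕ) * η 0 1) * rep k (φ (j - 1)) j l +
      ((k - (j : ℕ)) * η 1 0) * rep k (φ (j + 1)) j l := by
    intro j
    rw [sum_mul_rep (fun i => rep k (φ i) j l) (fun _ => η) j]
    ring
  rw [Matrix.trace_mul_comm, Matrix.trace]
  simp only [Matrix.diag_apply, Matrix.mul_apply, Matrix.of_apply, h1]
  rw [Finset.sum_add_distrib, Finset.sum_add_distrib,
    sum_mul_rep (fun j => (k - (j : ℝ)) * η 0 0 + (j : ℝ) * η 1 1) φ l,
    sum_mul_rep (fun j => (j : ℝ) * η 0 1) (fun j => φ (j - 1)) l,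
    sum_mul_rep (fun j => (k - (j : ℝ)) * η 1 0) (fun j => φ (j + 1)) l]
  rcases Nat.eq_zero_or_pos (l : ℕ) with h | h
  · simp [h]; ring
  · have e4 : (((l : ℕ) - 1 : ℕ) : ℝ) = (l : ℕ) - 1 := by
      rw [Nat.cast_sub (by omega)]; simp
    have e5 : (l : ℕ) - 1 - 1 = l - 2 := by omega
    have e6 : (l : ℕ) - 1 + 1 = l := by omega
    have e7 : (l : ℕ) + 1 - 1 = l := by omega
    simp only [e4, e5, e6, e7]
    push_cast
    ring

/-- The normalization equations within one weight space have only the trivial solution. -/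
lemma weight_system_eq_zero {a b k α β γ P Q R S : ℝ} (ha : 0 ≤ a) (hb : 0 ≤ b)
    (hk : a + b = k) (hk3 : 3 ≤ k) (hγ : k < γ) (hγ' : 2 * γ + 4 ≠ (k + 1) * (k + 2))
    (hsum : α + β = k ^ 2 * (k + 1) / 2) (hdiff : α - β = γ)
    (h1 : α * P + β * Q - a * (a * P + b * Q) - (a + 1) * R - (a - 1) * S = 0)
    (h2 : β * P + α * Q - b * (a * P + b * Q) - (b - 1) * R - (b + 1) * S = 0)
    (h3 : γ * S - a * (b + 1) * ((a - 1) * P + (b + 1) * Q) - a * (b + 1) * R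
      - (b + 2) * (a - 1) * S = 0)
    (h4 : γ * R - b * (a + 1) * ((a + 1) * P + (b - 1) * Q) - (a + 2) * (b - 1) * R
      - b * (a + 1) * S = 0) : P = 0 ∧ Q = 0 ∧ R = 0 ∧ S = 0 := by
  -- In terms of `t`, `N`, `v` the last two equations become diagonal in `S` and `R`, with
  -- coefficients `γ + 2 - t` and `γ + 2 + t`; hence the shift `c = γ + 2`.
  obtain ⟨c, rfl⟩ : ∃ c, γ = c - 2 := ⟨γ + 2, by ring⟩
  obtain ⟨t, ht⟩ : ∃ t, a - b = t := ⟨_, rfl⟩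
  obtain ⟨N, hN⟩ : ∃ N, a * P + b * Q + R + S = N := ⟨_, rfl⟩
  obtain ⟨v, hv⟩ : ∃ v, P - Q = v := ⟨_, rfl⟩
  have hα : α = (k ^ 2 * (k + 1) / 2 + (c - 2)) / 2 := by linarith
  have hβ : β = (k ^ 2 * (k + 1) / 2 - (c - 2)) / 2 := by linarith
  have e1 : (c - t) * S = a * (b + 1) * (N - v) := by
    rw [← hN, ← hv, ← ht]; linear_combination h3
  have e2 : (c + t) * R = b * (a + 1) * (N + v) := by
    rw [← hN, ← hv, ← ht]; linear_combination h4
  have hk0 : k ≠ 0 := by linarith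
  have e3 : k * (k + 1) / 2 * (P + Q) = N := by
    apply mul_left_cancel₀ hk0
    rw [← hN]
    linear_combination h1 + h2 - (P + Q) * hsum + (a * P + b * Q + R + S) * hk
  have e4 : (c - 2) * v = t * N + 2 * (R - S) := by
    rw [← hN, ← hv, ← ht]
    linear_combination h1 - h2 - (P - Q) * hdiff
  have e5 : k * N = (k + 1) * (t * v / 2 + R + S) := by
    have : N = k * (P + Q) / 2 + t * v / 2 + R + S := by
      rw [← hN, ← hv, ← ht, ← hk]; ring
    linear_combination (k + 1) * this + e3
  have hct : c - t ≠ 0 := by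
    have : t ≤ k := by linarith
    linarith [this] |> fun h : 0 < c - t => h.ne'
  have hct' : c + t ≠ 0 := by
    have : -k ≤ t := by linarith
    linarith [this] |> fun h : 0 < c + t => h.ne'
  have hG : (c - k - 2) * (c + k) ≠ 0 :=
    mul_ne_zero (by linarith) (by linarith)
  -- Multiplying `e4` by `c ^ 2 - t ^ 2` eliminates `R` and `S`; the common factor `(c - k - 2) * (c
  -- + k)` that comes out is nonzero since `c > k + 2`.
  have e6 : c * v = t * N := by
    apply mul_left_cancel₀ hG
    have hb' : b = (k - t) / 2 := by linarith
    have ha' : a = (k + t) / 2 := by linarith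
    subst hb' ha'
    linear_combination (c - t) * (c + t) * e4 + 2 * (c - t) * e2 - 2 * (c + t) * e1
  -- Eliminating `R`, `S` and `v` from `e5` leaves only `N`. The first factor is nonzero because
  -- `|t| ≤ k < c`, the second by `hγ'`.
  have e7 : (c ^ 2 - t ^ 2) * (2 * c - (k + 1) * (k + 2)) * (k * N) = 0 := by
    have hb' : b = (k - t) / 2 := by linarith
    have ha' : a = (k + t) / 2 := by linarith
    subst hb' ha'
    linear_combination 2 * c * (c - t) * (c + t) * e5 + 2 * c * (k + 1) * ((c - t) * e2 + (c + t) * e1)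
      + (k + 1) * t * ((c - k - 2) * (c + k)) * e6
  have hN0 : N = 0 := by
    have h5 : (c ^ 2 - t ^ 2) ≠ 0 := by
      have : c ^ 2 - t ^ 2 = (c - t) * (c + t) := by ring
      rw [this]; exact mul_ne_zero hct hct'
    have h6 : 2 * c - (k + 1) * (k + 2) ≠ 0 := fun h => hγ' (by linarith)
    simpa [h5, h6, hk0] using e7
  have hv0 : v = 0 := by
    have : c ≠ 0 := by linarith
    simpa [hN0, this] using e6
  have hu : P + Q = 0 := by
    have : k * (k + 1) / 2 ≠ 0 := by positivity
    rw [hN0] at e3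
    exact (mul_eq_zero.mp e3).resolve_left this
  rw [hN0, hv0] at e1 e2
  refine ⟨by linarith, by linarith, ?_, ?_⟩
  · simpa [hct'] using e2
  · simpa [hct] using e1

/-- The conditions decouple by weight: the diagonal of `φ l` interacts only with the `(0, 1)` entry
of `φ (l - 1)` and the `(1, 0)` entry of `φ (l + 1)`. The two extreme entries, `(1, 0)` of `φ 0` and
`(0, 1)` of `φ k`, stand alone. -/
lemma torsionPart_injective (hk : 3 ≤ k) (φ : Fin (k + 1) → Matrix (Fin 2) (Fin 2) ℝ)
    (h : ∀ l, torsionPart φ l ∈ gkPerp k) : φ = 0 := by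
  classical
  -- Extension by zero gives a meaning to neighbouring indices; out-of-range values only occur with
  -- coefficient zero.
  set ψ : ℕ → Matrix (Fin 2) (Fin 2) ℝ := fun n => if hn : n < k + 1 then φ ⟨n, hn⟩ else 0 with hψ
  have hψφ : ∀ j : Fin (k + 1), φ j = ψ j := fun j => by simp only [hψ]; rw [dif_pos j.2]
  have key : ∀ (l : ℕ) (hl : l ≤ k) (η : Matrix (Fin 2) (Fin 2) ℝ),
      (rep k η * rep k (ψ l)).trace =
      (rep k η * Matrix.of fun i j : Fin (k + 1) =>
        rep k (ψ j) i (⟨l, Nat.lt_succ_of_le hl⟩ : Fin (k + 1))).trace := by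
    intro l hl η
    have := h ⟨l, Nat.lt_succ_of_le hl⟩ (rep k η) ⟨η, rfl⟩
    have h2 : torsionPart φ ⟨l, Nat.lt_succ_of_le hl⟩ = rep k (ψ l) -
      Matrix.of fun i j : Fin (k + 1) => rep k (ψ j) i (⟨l, Nat.lt_succ_of_le hl⟩ : Fin (k + 1)) := by
      ext i j
      simp [torsionPart, hψφ]
    rw [h2, mul_sub, Matrix.trace_sub] at this
    linarith
  simp only [trace_rep_mul_rep, trace_rep_mul_contraction] at key
  have hP : ∀ l ≤ k, _ := fun l hl => key l hl (Matrix.single 0 0 1)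
  have hQ : ∀ l ≤ k, _ := fun l hl => key l hl (Matrix.single 1 1 1)
  have hE : ∀ l ≤ k, _ := fun l hl => key l hl (Matrix.single 0 1 1)
  have hF : ∀ l ≤ k, _ := fun l hl => key l hl (Matrix.single 1 0 1)
  simp [Matrix.single] at hP hQ hE hF
  have hk3 : (3 : ℝ) ≤ k := by exact_mod_cast hk
  have hγ : (k : ℝ) < k * (k + 1) * (k + 2) / 6 := by
    have : (20 : ℝ) ≤ (k + 1) * (k + 2) := by nlinarith
    nlinarith
  -- For `k = 1` and `k = 2` the two sides are equal, so this is where `3 ≤ k` is essential.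
  have hγ' : 2 * ((k : ℝ) * (k + 1) * (k + 2) / 6) + 4 ≠ (k + 1) * (k + 2) := by
    apply ne_of_gt; nlinarith
  have hdiag : ∀ l ≤ k, ψ l 0 0 = 0 ∧ ψ l 1 1 = 0 ∧ (l : ℝ) * ψ (l - 1) 0 1 = 0 ∧
      ((k : ℝ) - l) * ψ (l + 1) 1 0 = 0 := by
    intro l hl
    have hlk : (l : ℝ) ≤ k := by exact_mod_cast hl
    apply weight_system_eq_zero (a := k - l) (b := l) (k := k)
      (α := k * (k + 1) * (2 * k + 1) / 6) (β := k * (k + 1) * (k - 1) / 6)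
      (γ := k * (k + 1) * (k + 2) / 6) (R := l * ψ (l - 1) 0 1)
      (S := (k - l) * ψ (l + 1) 1 0) (by linarith) (by positivity) (by ring) hk3 hγ hγ'
      (by ring) (by ring)
    · linear_combination hP l hl
    · linear_combination hQ l hl
    -- The equation for the `(0, 1)` test matrix is taken at `l + 1` and the one for `(1, 0)` at `l
    -- - 1`, to land in the same weight; the factors `k - l` and `l` make both trivial at the ends.
    · rcases hl.eq_or_lt with rfl | hl'
      · simp
      · have := hE (l + 1) hl'
        simp only [Nat.add_sub_cancel, show l + 1 - 2 = l - 1 by omega] at this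
        push_cast at this
        linear_combination (k - l : ℝ) * this
    · rcases Nat.eq_zero_or_pos l with rfl | hl'
      · simp
      · have := hF (l - 1) (by omega)
        simp only [Nat.sub_add_cancel hl', show l - 1 + 2 = l + 1 by omega,
          Nat.cast_sub hl'] at this
        push_cast at this
        linear_combination (l : ℝ) * this
  have hlow : ∀ l ≤ k, ψ l 1 0 = 0 := by
    intro l hl
    -- The `(1, 0)` entry at index `0` belongs to no block; its own equation is `(γ - k) * ψ 0 1 0 =
    -- 0` with `γ > k`.
    rcases l with _ | l
    · have := hE 0 hl
      simp only [Nat.cast_zero] at this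
      have h0 : ((k : ℝ) * (k + 1) * (k + 2) / 6 - k) * ψ 0 1 0 = 0 := by linear_combination this
      exact (mul_eq_zero.mp h0).resolve_left (by linarith)
    · refine (mul_eq_zero.mp (hdiag l (by omega)).2.2.2).resolve_left ?_
      have : (l : ℝ) + 1 ≤ k := by exact_mod_cast hl
      linarith
  have hup : ∀ l ≤ k, ψ l 0 1 = 0 := by
    intro l hl
    rcases hl.eq_or_lt with rfl | hl'
    · have := hF l hl
      have h0 : ((l : ℝ) * (l + 1) * (l + 2) / 6 - l) * ψ l 0 1 = 0 := by linear_combination this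
      exact (mul_eq_zero.mp h0).resolve_left (by linarith)
    · have := (hdiag (l + 1) hl').2.2.1
      rw [Nat.add_sub_cancel] at this
      refine (mul_eq_zero.mp this).resolve_left ?_
      positivity
  funext j
  rw [hψφ]
  have hj : (j : ℕ) ≤ k := by omega
  ext a b
  fin_cases a <;> fin_cases b <;> simp [hdiag _ hj, hlow _ hj, hup _ hj]

lemma matrix_two_eq_sum (g : Matrix (Fin 2) (Fin 2) ℝ) :
    g = ∑ a, ∑ b, g a b • Matrix.single a b (1 : ℝ) := by
  ext i j
  fin_cases i <;> fin_cases j <;> simp [Matrix.single]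

lemma mem_gkPerp_iff {ψ : Matrix (Fin (k + 1)) (Fin (k + 1)) ℝ} :
    ψ ∈ gkPerp k ↔ ∀ a b, (rep k (Matrix.single a b 1) * ψ).trace = 0 := by
  refine ⟨fun h a b => h _ ⟨_, rfl⟩, fun h η hη => ?_⟩
  obtain ⟨g, rfl⟩ := hη
  rw [matrix_two_eq_sum g]
  simp only [map_sum, map_smul, Finset.sum_mul, Matrix.trace_sum, Matrix.smul_mul,
    Matrix.trace_smul, h, smul_zero, Finset.sum_const_zero]

lemma torsionPart_add (φ φ' : Fin (k + 1) → Matrix (Fin 2) (Fin 2) ℝ) (l : Fin (k + 1)) :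
    torsionPart (φ + φ') l = torsionPart φ l + torsionPart φ' l := by
  ext i j
  simp [torsionPart]; ring

lemma torsionPart_smul (c : ℝ) (φ : Fin (k + 1) → Matrix (Fin 2) (Fin 2) ℝ) (l : Fin (k + 1)) :
    torsionPart (c • φ) l = c • torsionPart φ l := by
  ext i j
  simp [torsionPart]; ring

/-- The obstruction of `torsionPart φ` to lie in `𝔤_k^⊥`. -/
def normalizationMap (k : ℕ) : (Fin (k + 1) → Matrix (Fin 2) (Fin 2) ℝ) →ₗ[ℝ]
    (Fin (k + 1) → Matrix (Fin 2) (Fin 2) ℝ) where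
  toFun φ l := Matrix.of fun a b => (rep k (Matrix.single a b 1) * torsionPart φ l).trace
  map_add' φ φ' := by
    ext l a b
    simp [torsionPart_add, mul_add]
  map_smul' c φ := by
    ext l a b
    simp [torsionPart_smul]

/-- Every torsion can be normalized by a connection form, depending linearly on the torsion. -/
lemma exists_normalizing (hk : 3 ≤ k) :
    ∃ s : (Fin (k + 1) → Matrix (Fin (k + 1)) (Fin (k + 1)) ℝ) →ₗ[ℝ]
      (Fin (k + 1) → Matrix (Fin 2) (Fin 2) ℝ),
      ∀ c l, torsionPart (s c) l - c l ∈ gkPerp k := by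
  have hinj : Function.Injective (normalizationMap k) := by
    rw [injective_iff_map_eq_zero]
    intro φ hφ
    apply torsionPart_injective hk
    intro l
    rw [mem_gkPerp_iff]
    intro a b
    exact congrFun (congrFun (congrFun hφ l) a) b
  let L := LinearEquiv.ofInjectiveEndo (normalizationMap k) hinj
  let K : (Fin (k + 1) → Matrix (Fin (k + 1)) (Fin (k + 1)) ℝ) →ₗ[ℝ]
      (Fin (k + 1) → Matrix (Fin 2) (Fin 2) ℝ) :=
    { toFun := fun c l => Matrix.of fun a b => (rep k (Matrix.single a b 1) * c l).trace
      map_add' := fun c c' => by ext l a b; simp [mul_add]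
      map_smul' := fun r c => by ext l a b; simp }
  refine ⟨L.symm.toLinearMap ∘ₗ K, fun c l => ?_⟩
  rw [mem_gkPerp_iff]
  intro a b
  have h1 : normalizationMap k (L.symm (K c)) = K c := L.apply_symm_apply (K c)
  have h2 : (rep k (Matrix.single a b 1) * torsionPart (L.symm (K c)) l).trace =
    (rep k (Matrix.single a b 1) * c l).trace := congrFun (congrFun (congrFun h1 l) a) b
  rw [mul_sub, Matrix.trace_sub]
  exact sub_eq_zero.mpr h2

end Algebra

/-! ### Symmetric products, derivations and frame independence. -/

section Symmetric

variable {k : ℕ} {W V : Type*} [AddCommGroup W] [Module ℝ W] [AddCommGroup V] [Module ℝ V]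

/-- The word `x ^ (k-j) y ^ j`. -/
def word (k : ℕ) (u : Fin 2 → W) (j : ℕ) (i : Fin k) : W := if (i : ℕ) + j < k then u 0 else u 1

/-- A multilinear map is symmetric. -/
def IsSymm (T : MultilinearMap ℝ (fun _ : Fin k => W) V) : Prop :=
  ∀ (e : Equiv.Perm (Fin k)) (v : Fin k → W), T (fun i => v (e i)) = T v

/-- The number of letters `1` in a word. -/
def ones (w : Fin k → Fin 2) : ℕ := (Finset.univ.filter fun i => w i = 1).card

lemma ones_le (w : Fin k → Fin 2) : ones w ≤ k := by
  simpa [ones] using Finset.card_le_univ (Finset.univ.filter fun i => w i = 1)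

lemma card_zeros (w : Fin k → Fin 2) : (Finset.univ.filter fun i => w i = 0).card = k - ones w := by
  have := Finset.card_filter_add_card_filter_not (s := (Finset.univ : Finset (Fin k)))
    (fun i => w i = 1)
  have h2 : (Finset.univ.filter fun i => ¬ w i = 1) = Finset.univ.filter fun i => w i = 0 := by
    ext i; simp; omega
  rw [h2] at this
  simp at this
  unfold ones
  omega

lemma ones_sorted {j : ℕ} (hj : j ≤ k) :
    ones (fun i : Fin k => if (i : ℕ) + j < k then (0 : Fin 2) else 1) = j := by
  have h : (Finset.univ.filter fun i : Fin k => (if (i : ℕ) + j < k then (0 : Fin 2) else 1) = 0) =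
      Finset.univ.filter fun i : Fin k => (i : ℕ) < k - j := by
    ext i; simp; omega
  have := card_zeros (fun i : Fin k => if (i : ℕ) + j < k then (0 : Fin 2) else 1)
  rw [h, Fin.card_filter_val_lt] at this
  have := ones_le (fun i : Fin k => if (i : ℕ) + j < k then (0 : Fin 2) else 1)
  omega

lemma exists_perm_of_ones_eq {w w' : Fin k → Fin 2} (h : ones w = ones w') :
    ∃ e : Equiv.Perm (Fin k), ∀ i, w' (e i) = w i := by
  have hc : ∀ c : Fin 2, Nonempty ({i // w i = c} ≃ {i // w' i = c}) := by
    intro c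
    rw [← Fintype.card_eq, Fintype.card_subtype, Fintype.card_subtype]
    have h0 := card_zeros w
    have h0' := card_zeros w'
    rw [← h, ← h0] at h0'
    fin_cases c
    · exact h0'.symm
    · exact h
  exact ⟨Equiv.ofFiberEquiv fun c => (hc c).some, fun i => Equiv.ofFiberEquiv_map _ i⟩

/-- Two words with equally many letters `1` differ by a permutation of positions, so a product
depends only on that number. -/
lemma IsSymm.apply_comp {T : MultilinearMap ℝ (fun _ : Fin k => W) V} (hT : IsSymm T)
    (u : Fin 2 → W) (w : Fin k → Fin 2) : T (fun i => u (w i)) = T (word k u (ones w)) := by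
  obtain ⟨e, he⟩ := exists_perm_of_ones_eq (ones_sorted (ones_le w))
  rw [← hT e]
  congr 1
  ext i
  simp only [word, he]
  split_ifs <;> rfl

/-- The derivation extension of an endomorphism to products. -/
def der (T : MultilinearMap ℝ (fun _ : Fin k => W) V) (A : W →ₗ[ℝ] W) :
    MultilinearMap ℝ (fun _ : Fin k => W) V :=
  ∑ i, T.compLinearMap fun l => if l = i then A else LinearMap.id

lemma der_apply (T : MultilinearMap ℝ (fun _ : Fin k => W) V) (A : W →ₗ[ℝ] W) (v : Fin k → W) :
    der T A v = ∑ i, T (Function.update v i (A (v i))) := by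
  simp only [der, _root_.sum_apply, MultilinearMap.compLinearMap_apply]
  refine Finset.sum_congr rfl fun i _ => congrArg T ?_
  ext l
  by_cases h : l = i
  · subst h; simp
  · simp [h]

lemma ones_update_one {w : Fin k → Fin 2} {i : Fin k} (h : w i = 0) :
    ones (Function.update w i 1) = ones w + 1 := by
  have : (Finset.univ.filter fun l => Function.update w i 1 l = 1) =
      insert i (Finset.univ.filter fun l => w l = 1) := by
    ext l
    by_cases hl : l = i
    · subst hl; simp
    · simp [hl]
  rw [ones, this, Finset.card_insert_of_notMem (by simp [h]), ones]

lemma ones_update_zero {w : Fin k → Fin 2} {i : Fin k} (h : w i = 1) :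
    ones (Function.update w i 0) = ones w - 1 := by
  have : (Finset.univ.filter fun l => Function.update w i 0 l = 1) =
      (Finset.univ.filter fun l => w l = 1).erase i := by
    ext l
    by_cases hl : l = i
    · subst hl; simp
    · simp [hl]
  rw [ones, this, Finset.card_erase_of_mem (by simp [h]), ones]

/-- This identifies `rep k` with the derivation action: each of the `k - c` letters `0` and `c`
letters `1` is replaced in turn by its image, and the counts produce the coefficients of column `c`.
-/
lemma der_word {T : MultilinearMap ℝ (fun _ : Fin k => W) V} (hT : IsSymm T) {A : W →ₗ[ℝ] W}
    {u : Fin 2 → W} {g : Matrix (Fin 2) (Fin 2) ℝ} (hA : ∀ a, A (u a) = g 0 a • u 0 + g 1 a • u 1)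
    (w : Fin k → Fin 2) (c : Fin (k + 1)) (hc : ones w = c) :
    der T A (fun i => u (w i)) = ∑ j : Fin (k + 1), rep k g j c • T (word k u j) := by
  rw [sum_rep_smul (fun n => T (word k u n)) (fun _ => g), der_apply]
  have hup : ∀ i b, T (Function.update (fun i => u (w i)) i (u b)) =
      T (word k u (ones (Function.update w i b))) := by
    intro i b
    rw [← hT.apply_comp]
    congr 1
    ext l
    by_cases hl : l = i
    · subst hl; simp
    · simp [hl]
  have hself : ∀ i, Function.update w i (w i) = w := fun i => Function.update_eq_self i w
  have hterm : ∀ i, T (Function.update (fun i => u (w i)) i (A (u (w i)))) =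
      if w i = 1 then g 0 1 • T (word k u (c - 1)) + g 1 1 • T (word k u c)
      else g 0 0 • T (word k u c) + g 1 0 • T (word k u (c + 1)) := by
    intro i
    rw [hA, T.map_update_add, T.map_update_smul, T.map_update_smul, hup, hup]
    by_cases h : w i = 1
    · have := hself i
      rw [h] at this
      rw [if_pos h, ones_update_zero h, this, hc, h]
    · have h0 : w i = 0 := by omega
      have := hself i
      rw [h0] at this
      rw [if_neg h, ones_update_one h0, this, hc, h0]
  simp only [hterm]
  have hz : (Finset.univ.filter fun i => ¬ w i = 1).card = k - c := by
    rw [← hc, ← card_zeros]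
    congr 1
    ext i; simp; omega
  have ho : (Finset.univ.filter fun i => w i = 1).card = c := hc
  rw [Finset.sum_ite, Finset.sum_const, Finset.sum_const, ho, hz, ← Nat.cast_smul_eq_nsmul ℝ,
    ← Nat.cast_smul_eq_nsmul ℝ, Nat.cast_sub (by omega)]
  module

lemma apply_sum_smul (T : MultilinearMap ℝ (fun _ : Fin k => W) V) (u : Fin 2 → W)
    (f : Fin k → Fin 2 → ℝ) :
    T (fun i => ∑ a, f i a • u a) =
      ∑ r : Fin k → Fin 2, (∏ i, f i (r i)) • T (fun i => u (r i)) := by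
  rw [T.map_sum]
  exact Finset.sum_congr rfl fun r _ => T.map_smul_univ _ _

/-- Expanding each factor in the basis `u` and sorting words gives all products. With the dimension
`k + 1` known on the tangent side, spanning is enough for a basis. -/
lemma span_word {T : MultilinearMap ℝ (fun _ : Fin k => W) V} (hT : IsSymm T)
    (hspan : Submodule.span ℝ (Set.range T) = ⊤) (u : Module.Basis (Fin 2) ℝ W) :
    ⊤ ≤ Submodule.span ℝ (Set.range fun j : Fin (k + 1) => T (word k u j)) := by
  rw [← hspan, Submodule.span_le]
  rintro _ ⟨v, rfl⟩
  have hv : v = fun i => ∑ a, u.repr (v i) a • u a := by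
    ext i; exact (u.sum_repr (v i)).symm
  rw [hv, apply_sum_smul]
  refine Submodule.sum_mem _ fun r _ => Submodule.smul_mem _ _ (Submodule.subset_span ?_)
  exact ⟨⟨ones r, Nat.lt_succ_of_le (ones_le r)⟩, (hT.apply_comp u r).symm⟩

/-- The basis `x ^ k, x ^ (k-1) y, …, y ^ k` of the space of products. -/
def wordBasis {T : MultilinearMap ℝ (fun _ : Fin k => W) V} (hT : IsSymm T)
    (hspan : Submodule.span ℝ (Set.range T) = ⊤) (hV : Module.finrank ℝ V = k + 1)
    (u : Module.Basis (Fin 2) ℝ W) : Module.Basis (Fin (k + 1)) ℝ V :=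
  basisOfTopLeSpanOfCardEqFinrank (fun j : Fin (k + 1) => T (word k u j)) (span_word hT hspan u)
    (by simp [hV])

section Basis

variable {T : MultilinearMap ℝ (fun _ : Fin k => W) V} (hT : IsSymm T)
    (hspan : Submodule.span ℝ (Set.range T) = ⊤) (hV : Module.finrank ℝ V = k + 1)
    (u : Module.Basis (Fin 2) ℝ W)

@[simp]
lemma wordBasis_apply (j : Fin (k + 1)) : wordBasis hT hspan hV u j = T (word k u j) := by
  simp [wordBasis]

lemma toMatrix_apply_two (A : W →ₗ[ℝ] W) (a : Fin 2) :
    A (u a) = LinearMap.toMatrix u u A 0 a • u 0 + LinearMap.toMatrix u u A 1 a • u 1 := by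
  rw [← u.sum_repr (A (u a)), Fin.sum_univ_two]
  simp [LinearMap.toMatrix_apply]

/-- The operator on the left is thereby expressed without reference to `u`, which is what makes
`𝔤_k` independent of the adapted frame. -/
lemma toLin_rep_apply (A : W →ₗ[ℝ] W) (v : Fin k → W) :
    Matrix.toLin (wordBasis hT hspan hV u) (wordBasis hT hspan hV u)
      (rep k (LinearMap.toMatrix u u A)) (T v) = der T A v := by
  set χ := wordBasis hT hspan hV u
  suffices h : (Matrix.toLin χ χ (rep k (LinearMap.toMatrix u u A))).compMultilinearMap T =
      der T A from congrFun (congrArg DFunLike.coe h) v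
  refine Module.Basis.ext_multilinear (fun _ => u) fun r => ?_
  have hr : ones r < k + 1 := Nat.lt_succ_of_le (ones_le r)
  rw [der_word hT (toMatrix_apply_two u A) r ⟨ones r, hr⟩ rfl, LinearMap.compMultilinearMap_apply,
    hT.apply_comp u r]
  have : T (word k u (ones r)) = χ ⟨ones r, hr⟩ := (wordBasis_apply hT hspan hV u ⟨ones r, hr⟩).symm
  rw [this, Matrix.toLin_self]
  simp [χ]

lemma trace_toLin_comp (η : Matrix (Fin (k + 1)) (Fin (k + 1)) ℝ)
    (χ : Module.Basis (Fin (k + 1)) ℝ V) (Θ : V →ₗ[ℝ] V) :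
    LinearMap.trace ℝ V (Matrix.toLin χ χ η ∘ₗ Θ) = (η * LinearMap.toMatrix χ χ Θ).trace := by
  rw [LinearMap.trace_eq_matrix_trace ℝ χ, LinearMap.toMatrix_comp χ χ χ, LinearMap.toMatrix_toLin]

/-- Frame independent description of trace orthogonality to `𝔤_k`. -/
lemma toMatrix_mem_gkPerp_iff (Θ : V →ₗ[ℝ] V) :
    LinearMap.toMatrix (wordBasis hT hspan hV u) (wordBasis hT hspan hV u) Θ ∈ gkPerp k ↔
      ∀ (A : W →ₗ[ℝ] W) (D : V →ₗ[ℝ] V), (∀ v, D (T v) = der T A v) →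
        LinearMap.trace ℝ V (D ∘ₗ Θ) = 0 := by
  set χ := wordBasis hT hspan hV u with hχ
  constructor
  · intro h A D hD
    have : D = Matrix.toLin χ χ (rep k (LinearMap.toMatrix u u A)) := by
      apply LinearMap.ext_on_range (v := T) hspan
      intro v
      rw [hD, toLin_rep_apply]
    rw [this, trace_toLin_comp]
    exact h _ ⟨_, rfl⟩
  · rintro h _ ⟨g, rfl⟩
    rw [← trace_toLin_comp]
    apply h (Matrix.toLin u u g)
    intro v
    rw [← toLin_rep_apply hT hspan hV u, LinearMap.toMatrix_toLin]

end Basis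

end Symmetric

/-! ### Regularity of coefficients in an arbitrary local frame. -/

section LocalFrame

variable {EM : Type*} [NormedAddCommGroup EM] [NormedSpace ℝ EM]
  {H : Type*} [TopologicalSpace H] {I : ModelWithCorners ℝ EM H}
  {M : Type*} [TopologicalSpace M] [ChartedSpace H M]
  {F : Type*} [NormedAddCommGroup F] [NormedSpace ℝ F] [FiniteDimensional ℝ F]
  {V : M → Type*} [TopologicalSpace (TotalSpace F V)]
  [∀ x, AddCommGroup (V x)] [∀ x, Module ℝ (V x)] [∀ x : M, TopologicalSpace (V x)]
  [FiberBundle F V] [VectorBundle ℝ F V] [ContMDiffVectorBundle 1 F V I]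
  {ι : Type*} [Fintype ι] {s : ι → (x : M) → V x} {u : Set M} {x : M} {n : ℕ∞ω}

lemma contMDiffAt_det [DecidableEq ι] {C : M → Matrix ι ι ℝ}
    (hC : ∀ i j, ContMDiffAt I 𝓘(ℝ) n (fun y => C y i j) x) :
    ContMDiffAt I 𝓘(ℝ) n (fun y => (C y).det) x := by
  simp only [Matrix.det_apply]
  refine contMDiffAt_finsetSum fun σ _ => ?_
  simp only [Units.smul_def, zsmul_eq_mul]
  exact contMDiffAt_const.mul (contMDiffAt_finsetProd fun i _ => hC _ _)

lemma contMDiffAt_inv [DecidableEq ι] {C : M → Matrix ι ι ℝ}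
    (hC : ∀ i j, ContMDiffAt I 𝓘(ℝ) n (fun y => C y i j) x) (hx : (C x).det ≠ 0) (i j : ι) :
    ContMDiffAt I 𝓘(ℝ) n (fun y => (C y)⁻¹ i j) x := by
  simp only [Matrix.inv_def, Matrix.smul_apply, smul_eq_mul, Ring.inverse_eq_inv',
    Matrix.adjugate_apply]
  refine ((contMDiffAt_det hC).inv₀ hx).mul (contMDiffAt_det fun a b => ?_)
  by_cases h : a = j
  · subst h; simpa using contMDiffAt_const
  · simpa [h] using hC a b

/-- Near a point, the coefficients in a local frame are obtained by a smooth matrix from the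
coefficients in a local frame given by a trivialization. -/
lemma exists_coeff_eq [ContMDiffVectorBundle n F V I]
    (hs : IsLocalFrameOn I F n s u) (hu : u ∈ nhds x) :
    ∃ (b : Module.Basis ι ℝ F) (P : M → Matrix ι ι ℝ),
      (∀ i j, ContMDiffAt I 𝓘(ℝ) n (fun y => P y i j) x) ∧
      ∀ᶠ y in nhds x, ∀ (t : (y : M) → V y) i, hs.coeff i y (t y) =
        ∑ j, P y i j * (trivializationAt F V x).localFrameCoeff I b j y (t y) := by
  classical
  have hx : x ∈ u := mem_of_mem_nhds hu
  set e := trivializationAt F V x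
  have hxe : x ∈ e.baseSet := FiberBundle.mem_baseSet_trivializationAt F V x
  -- The basis is chosen so that the frame of the trivialization equals `s` at `x`. The transition
  -- matrix `C` is then the identity at `x`, hence invertible nearby.
  set b : Module.Basis ι ℝ F := (hs.toBasisAt hx).map (e.linearEquivAt ℝ x hxe)
  set C : M → Matrix ι ι ℝ := fun y => Matrix.of fun i j => e.localFrameCoeff I b i y (s j y)
  have hC : ∀ i j, ContMDiffAt I 𝓘(ℝ) n (fun y => C y i j) x := fun i j =>
    contMDiffAt_localFrameCoeff b hxe ((hs.contMDiffOn j).contMDiffAt hu) i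
  have hCx : C x = 1 := by
    ext i j
    simp only [C, Matrix.of_apply]
    have hb : e.basisAt b hxe = hs.toBasisAt hx := by
      ext l
      simpa [b, Bundle.Trivialization.basisAt] using e.symm_apply_apply_mk hxe (s l x)
    rw [e.localFrameCoeff_apply_of_mem_baseSet b hxe, hb, ← hs.toBasisAt_coe hx,
      Module.Basis.repr_self, Finsupp.single_apply, Matrix.one_apply]
    simp only [eq_comm]

  refine ⟨b, fun y => (C y)⁻¹, contMDiffAt_inv hC (by simp [hCx]), ?_⟩
  have hdet : ∀ᶠ y in nhds x, (C y).det ≠ 0 :=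
    (contMDiffAt_det hC).continuousAt.eventually_ne (by simp [hCx])
  filter_upwards [hdet, hu] with y hy hyu t i
  have h1 : ∀ i, e.localFrameCoeff I b i y (t y) = (C y).mulVec (fun j => hs.coeff j y (t y)) i := by
    intro i
    conv_lhs => rw [hs.coeff_sum_eq t hyu]
    simp [Matrix.mulVec, dotProduct, C, mul_comm]
  have h2 : (fun j => hs.coeff j y (t y)) =
      (C y)⁻¹.mulVec (fun j => e.localFrameCoeff I b j y (t y)) := by
    rw [show (fun j => e.localFrameCoeff I b j y (t y)) = _ from funext h1, Matrix.mulVec_mulVec,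
      Matrix.nonsing_inv_mul _ (isUnit_iff_ne_zero.mpr hy), Matrix.one_mulVec]
  exact congrFun h2 i

lemma contMDiffAt_coeff [ContMDiffVectorBundle n F V I]
    (hs : IsLocalFrameOn I F n s u) (hu : u ∈ nhds x) {t : (y : M) → V y}
    (ht : ContMDiffAt I (I.prod 𝓘(ℝ, F)) n (fun y => (⟨y, t y⟩ : TotalSpace F V)) x) (i : ι) :
    ContMDiffAt I 𝓘(ℝ) n (fun y => hs.coeff i y (t y)) x := by
  obtain ⟨b, P, hP, h⟩ := exists_coeff_eq hs hu
  refine ContMDiffAt.congr_of_eventuallyEq ?_ (h.mono fun y hy => hy t i)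
  exact contMDiffAt_finsetSum fun j _ => (hP i j).mul
    (contMDiffAt_localFrameCoeff b (FiberBundle.mem_baseSet_trivializationAt F V x) ht j)

lemma mdifferentiableAt_coeff [ContMDiffVectorBundle n F V I] (hn : 1 ≤ n)
    (hs : IsLocalFrameOn I F n s u) (hu : u ∈ nhds x) {t : (y : M) → V y}
    (ht : MDifferentiableAt I (I.prod 𝓘(ℝ, F)) (fun y => (⟨y, t y⟩ : TotalSpace F V)) x) (i : ι) :
    MDifferentiableAt I 𝓘(ℝ) (fun y => hs.coeff i y (t y)) x := by
  obtain ⟨b, P, hP, h⟩ := exists_coeff_eq hs hu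
  refine MDifferentiableAt.congr_of_eventuallyEq ?_ (h.mono fun y hy => hy t i)
  have hsum : (fun y => ∑ j, P y i j * (trivializationAt F V x).localFrameCoeff I b j y (t y)) =
      ∑ j, fun y => P y i j * (trivializationAt F V x).localFrameCoeff I b j y (t y) := by
    ext y; simp
  rw [hsum]
  have hterm : ∀ j, MDifferentiableAt I 𝓘(ℝ)
      (fun y => P y i j * (trivializationAt F V x).localFrameCoeff I b j y (t y)) x := fun j =>
    ((hP i j).mdifferentiableAt (by positivity)).mul
      (mdifferentiableAt_localFrameCoeff b (FiberBundle.mem_baseSet_trivializationAt F V x) ht j)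
  exact Finset.sum_induction _ (fun f : M → ℝ => MDifferentiableAt I 𝓘(ℝ) f x)
    (fun _ _ hf hg => hf.add hg) mdifferentiableAt_const fun j _ => hterm j

end LocalFrame

/-! ### Smoothness of derivatives and of bundle endomorphisms. -/

section HomBundle

variable {EM : Type*} [NormedAddCommGroup EM] [NormedSpace ℝ EM]
  {H : Type*} [TopologicalSpace H] {I : ModelWithCorners ℝ EM H}
  {M : Type*} [TopologicalSpace M] [ChartedSpace H M] [IsManifold I ∞ M] {x : M}

lemma contMDiffAt_mvfderiv_apply {f : M → ℝ} (hf : ContMDiffAt I 𝓘(ℝ) ∞ f x)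
    {σ : (y : M) → TangentSpace I y}
    (hσ : ContMDiffAt I I.tangent ∞ (fun y => (⟨y, σ y⟩ : TangentBundle I M)) x) :
    ContMDiffAt I 𝓘(ℝ) ∞ (fun y => mvfderiv I f y (σ y)) x := by
  have h1 := hf.mfderiv_const (m := ∞) le_rfl
  have h2 := ((trivializationAt EM (TangentSpace I) x).contMDiffAt_section_iff
    (FiberBundle.mem_baseSet_trivializationAt EM (TangentSpace I) x)).1 hσ
  refine (h1.clm_apply h2).congr_of_eventuallyEq ?_
  filter_upwards [(trivializationAt EM (TangentSpace I) x).open_baseSet.mem_nhds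
    (FiberBundle.mem_baseSet_trivializationAt EM (TangentSpace I) x)] with y hy
  change _ = ContinuousLinearMap.inCoordinates EM (TangentSpace I) ℝ (TangentSpace 𝓘(ℝ, ℝ))
    x y (f x) (f y) (mfderiv I 𝓘(ℝ) f y) _
  simp only [ContinuousLinearMap.inCoordinates, ContinuousLinearMap.comp_apply]
  rw [← Bundle.Trivialization.continuousLinearMapAt_apply_of_mem ℝ _ hy,
    Bundle.Trivialization.symmL_continuousLinearMapAt _ hy]
  rw [TangentBundle.continuousLinearMapAt_model_space]
  rfl

/-- Testing on sections that are constant in the trivialization at `x` controls each column of the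
coordinate expression, and there are finitely many columns. -/
lemma contMDiffAt_hom_of_apply [FiniteDimensional ℝ EM]
    {A : (y : M) → TangentSpace I y →L[ℝ] TangentSpace I y}
    (hA : ∀ σ : (y : M) → TangentSpace I y,
      ContMDiffAt I I.tangent ∞ (fun y => (⟨y, σ y⟩ : TangentBundle I M)) x →
      ContMDiffAt I I.tangent ∞ (fun y => (⟨y, A y (σ y)⟩ : TangentBundle I M)) x) :
    ContMDiffAt I (I.prod 𝓘(ℝ, EM →L[ℝ] EM)) ∞
      (fun y => (⟨y, A y⟩ : TotalSpace (EM →L[ℝ] EM)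
        fun y : M => TangentSpace I y →L[ℝ] TangentSpace I y)) x := by
  rw [contMDiffAt_hom_bundle]
  refine ⟨contMDiffAt_id, ?_⟩
  set e := trivializationAt EM (TangentSpace I : M → Type _) x
  have hxe : x ∈ e.baseSet := FiberBundle.mem_baseSet_trivializationAt EM (TangentSpace I) x
  set G : M → EM →L[ℝ] EM := fun y => ContinuousLinearMap.inCoordinates EM
    (TangentSpace I : M → Type _) EM (TangentSpace I : M → Type _) x y x y (A y)
  change ContMDiffAt I 𝓘(ℝ, EM →L[ℝ] EM) ∞ G x
  have hG : ∀ v, ContMDiffAt I 𝓘(ℝ, EM) ∞ (fun y => G y v) x := by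
    intro v
    have h1 : ContMDiffAt I I.tangent ∞ (fun y => (⟨y, e.symmL ℝ y v⟩ : TangentBundle I M)) x := by
      refine (e.contMDiffAt_section_iff hxe).2 ?_
      refine (contMDiffAt_const (c := v)).congr_of_eventuallyEq ?_
      filter_upwards [e.open_baseSet.mem_nhds hxe] with y hy
      rw [← Bundle.Trivialization.continuousLinearMapAt_apply_of_mem ℝ _ hy,
        Bundle.Trivialization.continuousLinearMapAt_symmL _ hy]
    refine ((e.contMDiffAt_section_iff hxe).1 (hA _ h1)).congr_of_eventuallyEq ?_
    filter_upwards [e.open_baseSet.mem_nhds hxe] with y hy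
    rw [← Bundle.Trivialization.continuousLinearMapAt_apply_of_mem ℝ _ hy]
    rfl
  let b := Module.finBasis ℝ EM
  have hsum : G = fun y => ∑ i, ContinuousLinearMap.smulRightL ℝ EM EM
      (LinearMap.toContinuousLinearMap (b.coord i)) (G y (b i)) := by
    funext y
    ext v
    conv_lhs => rw [← b.sum_repr v, map_sum]
    simp
  rw [hsum]
  exact contMDiffAt_finsetSum fun i _ =>
    (ContinuousLinearMap.contMDiff _).contMDiffAt.comp x (hG (b i))

end HomBundle

/-! ### The connection with prescribed coefficients in a frame. -/

section FrameConnection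

variable {EM : Type*} [NormedAddCommGroup EM] [NormedSpace ℝ EM] [FiniteDimensional ℝ EM]
  {H : Type*} [TopologicalSpace H] {I : ModelWithCorners ℝ EM H}
  {M : Type*} [TopologicalSpace M] [ChartedSpace H M] [IsManifold I ∞ M] {p : M}
  {ι : Type*} [Fintype ι] {χ : ι → (q : M) → TangentSpace I q} {U : Set M}
  (hχ : IsLocalFrameOn I EM ∞ χ U) (Γ : M → ι → Matrix ι ι ℝ)

instance (p : M) : FiniteDimensional ℝ (TangentSpace I p) := inferInstanceAs (FiniteDimensional ℝ EM)

instance (p : M) : T2Space (TangentSpace I p) := inferInstanceAs (T2Space EM)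

omit [FiniteDimensional ℝ EM] [IsManifold I ∞ M] in
lemma mvfderiv_congr {f g : M → ℝ} (h : f =ᶠ[nhds p] g) : mvfderiv I f p = mvfderiv I g p := by
  have := h.mfderiv_eq (I := I) (I' := 𝓘(ℝ))
  ext X
  exact congrArg (fun L : TangentSpace I p →L[ℝ] ℝ => L X) this

/-- The connection with connection coefficients `Γ` in the frame `χ`:
`∇_{χ m} χ j = ∑ i, Γ m i j χ i`. -/
def frameCov (Y : (q : M) → TangentSpace I q) (p : M) :
    TangentSpace I p →L[ℝ] TangentSpace I p :=
  ∑ j, (mvfderiv I (fun q => hχ.coeff j q (Y q)) p).smulRight (χ j p) +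
  ∑ j, hχ.coeff j p (Y p) • ∑ i, ∑ m, Γ p m i j •
    (LinearMap.toContinuousLinearMap (hχ.coeff m p)).smulRight (χ i p)

lemma frameCov_add (hU : U ∈ nhds p) {Y Z : (q : M) → TangentSpace I q}
    (hY : MDifferentiableAt I I.tangent (fun q => (⟨q, Y q⟩ : TangentBundle I M)) p)
    (hZ : MDifferentiableAt I I.tangent (fun q => (⟨q, Z q⟩ : TangentBundle I M)) p) :
    frameCov hχ Γ (Y + Z) p = frameCov hχ Γ Y p + frameCov hχ Γ Z p := by
  have h : ∀ j, mvfderiv I (fun q => hχ.coeff j q ((Y + Z) q)) p =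
      mvfderiv I (fun q => hχ.coeff j q (Y q)) p + mvfderiv I (fun q => hχ.coeff j q (Z q)) p := by
    intro j
    rw [← mvfderiv_add (mdifferentiableAt_coeff (by simp) hχ hU hY j)
      (mdifferentiableAt_coeff (by simp) hχ hU hZ j)]
    congr 1
    ext q
    simp
  ext X
  simp only [frameCov, h]
  simp [add_smul, Finset.sum_add_distrib]
  abel

lemma frameCov_smul (hU : U ∈ nhds p) {Y : (q : M) → TangentSpace I q} {f : M → ℝ}
    (hY : MDifferentiableAt I I.tangent (fun q => (⟨q, Y q⟩ : TangentBundle I M)) p)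
    (hf : MDifferentiableAt I 𝓘(ℝ) f p) :
    frameCov hχ Γ (f • Y) p = f p • frameCov hχ Γ Y p + (mvfderiv I f p).smulRight (Y p) := by
  have h : ∀ j, mvfderiv I (fun q => hχ.coeff j q ((f • Y) q)) p =
      f p • mvfderiv I (fun q => hχ.coeff j q (Y q)) p + hχ.coeff j p (Y p) • mvfderiv I f p := by
    intro j
    rw [← mvfderiv_mul hf (mdifferentiableAt_coeff (by simp) hχ hU hY j)]
    congr 1
    ext q
    simp
  ext X
  conv_rhs => rw [hχ.coeff_sum_eq Y (mem_of_mem_nhds hU)]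
  simp only [frameCov, h]
  simp [add_smul, mul_smul, Finset.sum_add_distrib, Finset.smul_sum, smul_comm (hχ.coeff _ p (Y p))]
  abel

lemma frameCov_frame (hU : U ∈ nhds p) (j : ι) (X : TangentSpace I p) :
    frameCov hχ Γ (χ j) p X = ∑ i, (∑ m, hχ.coeff m p X * Γ p m i j) • χ i p := by
  classical
  have hc : ∀ q ∈ U, ∀ l, hχ.coeff l q (χ j q) = if j = l then 1 else 0 := by
    intro q hq l
    rw [hχ.coeff_apply_of_mem hq, ← hχ.toBasisAt_coe hq, Module.Basis.repr_self,
      Finsupp.single_apply]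
  have hd : ∀ l, mvfderiv I (fun q => hχ.coeff l q (χ j q)) p = 0 := by
    intro l
    have : (fun q => hχ.coeff l q (χ j q)) =ᶠ[nhds p] fun _ => if j = l then (1 : ℝ) else 0 :=
      Filter.eventually_of_mem hU fun q hq => hc q hq l
    rw [mvfderiv_congr this, mvfderiv_const]
  simp [frameCov, hd, hc p (mem_of_mem_nhds hU), Finset.sum_smul, mul_comm, mul_smul]

lemma contMDiffAt_frameCov (hU : U ∈ nhds p)
    (hΓ : ∀ m i j, ContMDiffAt I 𝓘(ℝ) ∞ (fun q => Γ q m i j) p)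
    {Y : (q : M) → TangentSpace I q}
    (hY : ContMDiffAt I I.tangent ∞ (fun q => (⟨q, Y q⟩ : TangentBundle I M)) p) :
    ContMDiffAt I (I.prod 𝓘(ℝ, EM →L[ℝ] EM)) ∞
      (fun q => (⟨q, frameCov hχ Γ Y q⟩ : TotalSpace (EM →L[ℝ] EM)
        fun q : M => TangentSpace I q →L[ℝ] TangentSpace I q)) p := by
  refine contMDiffAt_hom_of_apply fun σ hσ => ?_
  have h1 : ∀ q, frameCov hχ Γ Y q (σ q) =
      ∑ j, mvfderiv I (fun q => hχ.coeff j q (Y q)) q (σ q) • χ j q +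
      ∑ j, ∑ i, ∑ m, (hχ.coeff j q (Y q) * (Γ q m i j * hχ.coeff m q (σ q))) • χ i q := by
    intro q
    simp [frameCov, Finset.smul_sum, mul_smul]
  simp only [h1]
  have hχp : ∀ i, ContMDiffAt I I.tangent ∞ (fun q => (⟨q, χ i q⟩ : TangentBundle I M)) p :=
    fun i => (hχ.contMDiffOn i).contMDiffAt hU
  refine ContMDiffAt.add_section (ContMDiffAt.sum_section fun j _ => ?_)
    (ContMDiffAt.sum_section fun j _ => ContMDiffAt.sum_section fun i _ =>
      ContMDiffAt.sum_section fun m _ => ?_)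
  · exact (contMDiffAt_mvfderiv_apply (contMDiffAt_coeff hχ hU hY j) hσ).smul_section (hχp j)
  · exact ((contMDiffAt_coeff hχ hU hY j).mul ((hΓ m i j).mul
      (contMDiffAt_coeff hχ hU hσ m))).smul_section (hχp i)

end FrameConnection

/-! ### Leibniz rule for finite sums and products. -/

section CovariantDerivativeOn

variable {EM : Type*} [NormedAddCommGroup EM] [NormedSpace ℝ EM]
  {H : Type*} [TopologicalSpace H] {I : ModelWithCorners ℝ EM H}
  {M : Type*} [TopologicalSpace M] [ChartedSpace H M] {p : M}

lemma mdifferentiableAt_mvfderiv_prod {ι : Type*} [DecidableEq ι] (t : Finset ι) {f : ι → M → ℝ}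
    (hf : ∀ i, MDifferentiableAt I 𝓘(ℝ) (f i) p) :
    MDifferentiableAt I 𝓘(ℝ) (fun q => ∏ i ∈ t, f i q) p ∧
      ∀ X, mvfderiv I (fun q => ∏ i ∈ t, f i q) p X =
      ∑ i ∈ t, mvfderiv I (f i) p X * ∏ l ∈ t.erase i, f l p := by
  induction t using Finset.induction_on with
  | empty => simpa [mvfderiv_const] using mdifferentiableAt_const
  | insert a t ha ih =>
    have h : (fun q => ∏ i ∈ insert a t, f i q) = f a * fun q => ∏ i ∈ t, f i q := by
      ext q; simp [Finset.prod_insert ha]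
    rw [h]
    refine ⟨(hf a).mul ih.1, fun X => ?_⟩
    rw [mvfderiv_mul (hf a) ih.1, Finset.sum_insert ha, Finset.erase_insert ha]
    have h2 : ∑ i ∈ t, mvfderiv I (f i) p X * ∏ l ∈ (insert a t).erase i, f l p =
        f a p * ∑ i ∈ t, mvfderiv I (f i) p X * ∏ l ∈ t.erase i, f l p := by
      rw [Finset.mul_sum]
      refine Finset.sum_congr rfl fun i hi => ?_
      have hai : a ≠ i := fun h => ha (h ▸ hi)
      rw [Finset.erase_insert_of_ne hai, Finset.prod_insert (fun h => ha (Finset.mem_of_mem_erase h))]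
      ring
    rw [h2, ← ih.2 X]
    simp
    ring

variable [IsManifold I ∞ M]
  {cov : ((q : M) → TangentSpace I q) → (q : M) → TangentSpace I q →L[ℝ] TangentSpace I q}
  {U : Set M}

lemma cov_sum_smul (hcov : IsCovariantDerivativeOn EM cov U) (hp : p ∈ U) {ι : Type*}
    (t : Finset ι) {f : ι → M → ℝ} {s : ι → (q : M) → TangentSpace I q}
    (hf : ∀ i, MDifferentiableAt I 𝓘(ℝ) (f i) p)
    (hs : ∀ i, MDifferentiableAt I I.tangent (fun q => (⟨q, s i q⟩ : TangentBundle I M)) p)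
    (X : TangentSpace I p) :
    cov (fun q => ∑ i ∈ t, f i q • s i q) p X =
      ∑ i ∈ t, (f i p • cov (s i) p X + mvfderiv I (f i) p X • s i p) := by
  classical
  induction t using Finset.induction_on with
  | empty =>
    have := hcov.zero hp
    simp only [Finset.sum_empty]
    exact congrArg (fun L : TangentSpace I p →L[ℝ] TangentSpace I p => L X) this
  | insert a t ha ih =>
    have h : (fun q => ∑ i ∈ insert a t, f i q • s i q) =
        (f a • s a) + fun q => ∑ i ∈ t, f i q • s i q := by
      ext q; simp [Finset.sum_insert ha]
    have hsum : MDifferentiableAt I I.tangent (fun q =>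
        (⟨q, ∑ i ∈ t, f i q • s i q⟩ : TangentBundle I M)) p :=
      MDifferentiableAt.sum_section fun i _ => (hf i).smul_section (hs i)
    rw [h, hcov.add ((hf a).smul_section (hs a)) hsum hp,
      hcov.leibniz (hs a) (hf a) hp, Finset.sum_insert ha, add_apply, ih]
    simp

/-- Near `p` the field is a combination of the frame with differentiable coefficients, so locality
and the Leibniz rule reduce everything to the frame fields. -/
lemma cov_eq_of_frame [FiniteDimensional ℝ EM] (hcov : IsCovariantDerivativeOn EM cov U)
    {cov' : ((q : M) → TangentSpace I q) → (q : M) → TangentSpace I q →L[ℝ] TangentSpace I q}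
    (hcov' : IsCovariantDerivativeOn EM cov' U) (hU : U ∈ nhds p)
    {ι : Type*} [Fintype ι] {χ : ι → (q : M) → TangentSpace I q}
    (hχ : IsLocalFrameOn I EM ∞ χ U) (h : ∀ j, cov (χ j) p = cov' (χ j) p)
    {Y : (q : M) → TangentSpace I q}
    (hY : MDifferentiableAt I I.tangent (fun q => (⟨q, Y q⟩ : TangentBundle I M)) p) :
    cov Y p = cov' Y p := by
  have hp := mem_of_mem_nhds hU
  have hev := hχ.eventually_eq_sum_coeff_smul Y hU
  have hc : ∀ j, MDifferentiableAt I 𝓘(ℝ) (fun q => hχ.coeff j q (Y q)) p :=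
    mdifferentiableAt_coeff (by simp) hχ hU hY
  have hs : ∀ j, MDifferentiableAt I I.tangent (fun q => (⟨q, χ j q⟩ : TangentBundle I M)) p :=
    fun j => ((hχ.contMDiffOn j).contMDiffAt hU).mdifferentiableAt (by simp)
  have hsum : MDifferentiableAt I I.tangent (fun q =>
      (⟨q, ∑ i, hχ.coeff i q (Y q) • χ i q⟩ : TangentBundle I M)) p :=
    MDifferentiableAt.sum_section fun i _ => (hc i).smul_section (hs i)
  rw [hcov.congr_of_eventuallyEq hY hsum hU hev, hcov'.congr_of_eventuallyEq hY hsum hU hev]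
  ext X
  rw [cov_sum_smul hcov hp _ hc hs, cov_sum_smul hcov' hp _ hc hs]
  simp only [h]

lemma isCovariantDerivativeOn_frameCov [FiniteDimensional ℝ EM]
    {ι : Type*} [Fintype ι] {χ : ι → (q : M) → TangentSpace I q}
    (hχ : IsLocalFrameOn I EM ∞ χ U) (Γ : M → ι → Matrix ι ι ℝ) (hU : IsOpen U) :
    IsCovariantDerivativeOn EM (frameCov hχ Γ) U where
  add hσ hσ' hx := frameCov_add hχ Γ (hU.mem_nhds hx) hσ hσ'
  leibniz hσ hg hx := frameCov_smul hχ Γ (hU.mem_nhds hx) hσ hg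

end CovariantDerivativeOn

/-! ### Adapted frames and change of frame in `E`. -/

section Structure

variable {k : ℕ} {M : Type*} [TopologicalSpace M]
  [ChartedSpace (EuclideanSpace ℝ (Fin (k + 1))) M] [IsManifold (𝓡 (k + 1)) ∞ M]
  {F : Type*} [NormedAddCommGroup F] [NormedSpace ℝ F]
  {E : M → Type*} [TopologicalSpace (TotalSpace F E)]
  [∀ p, AddCommGroup (E p)] [∀ p, Module ℝ (E p)] [∀ p, TopologicalSpace (E p)]
  [FiberBundle F E] (S : GL2Structure k M F E) {p : M}

/-- The product of `k` vectors of `E_p`, as a tangent vector. -/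
def GL2Structure.prodMap (p : M) :
    MultilinearMap ℝ (fun _ : Fin k => E p) (TangentSpace (𝓡 (k + 1)) p) :=
  (S.iso p).toLinearMap.compMultilinearMap (SymmetricPower.tprod ℝ)

lemma GL2Structure.isSymm_prodMap (p : M) : IsSymm (S.prodMap p) := by
  intro e v
  exact congrArg (S.iso p) (SymmetricPower.tprod_equiv e v)

lemma GL2Structure.span_prodMap (p : M) : Submodule.span ℝ (Set.range (S.prodMap p)) = ⊤ := by
  have : Set.range (S.prodMap p) = (S.iso p).toLinearMap '' Set.range (SymmetricPower.tprod ℝ) := by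
    rw [← Set.range_comp]; rfl
  rw [this, Submodule.span_image, SymmetricPower.span_tprod_eq_top, Submodule.map_top,
    LinearEquiv.range]

omit [IsManifold (𝓡 (k + 1)) ∞ M] in
lemma finrank_tangentSpace (p : M) : Module.finrank ℝ (TangentSpace (𝓡 (k + 1)) p) = k + 1 :=
  (finrank_euclideanSpace_fin : Module.finrank ℝ (EuclideanSpace ℝ (Fin (k + 1))) = k + 1)

/-- The adapted frame as a basis. -/
def GL2Structure.frameBasis (p : M) (u : Module.Basis (Fin 2) ℝ (E p)) :
    Module.Basis (Fin (k + 1)) ℝ (TangentSpace (𝓡 (k + 1)) p) :=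
  wordBasis (S.isSymm_prodMap p) (S.span_prodMap p) (finrank_tangentSpace p) u

@[simp]
lemma GL2Structure.frameBasis_apply (u : Module.Basis (Fin 2) ℝ (E p)) (j : Fin (k + 1)) :
    S.frameBasis p u j = S.frame p u j := wordBasis_apply ..

/-- The field of adapted frames of a frame of `E`. -/
def GL2Structure.frameField (e : Fin 2 → (p : M) → E p) (j : Fin (k + 1)) (p : M) :
    TangentSpace (𝓡 (k + 1)) p := S.frame p (fun a => e a p) j

variable {U : Set M} {e : Fin 2 → (p : M) → E p}

omit [IsManifold (𝓡 (k + 1)) ∞ M] in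
lemma toBasisAt_funext (he : IsLocalFrameOn (𝓡 (k + 1)) F ∞ e U) (hp : p ∈ U) :
    (he.toBasisAt hp : Fin 2 → E p) = fun a => e a p := funext fun a => he.toBasisAt_coe hp a

lemma GL2Structure.frameBasis_toBasisAt (he : IsLocalFrameOn (𝓡 (k + 1)) F ∞ e U) (hp : p ∈ U)
    (j : Fin (k + 1)) : S.frameBasis p (he.toBasisAt hp) j = S.frameField e j p := by
  rw [S.frameBasis_apply, toBasisAt_funext]; rfl

lemma GL2Structure.isLocalFrameOn_frameField (he : IsLocalFrameOn (𝓡 (k + 1)) F ∞ e U)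
    (hU : IsOpen U) :
    IsLocalFrameOn (𝓡 (k + 1)) (EuclideanSpace ℝ (Fin (k + 1))) ∞ (S.frameField e) U where
  linearIndependent {p} hp := by
    have := (S.frameBasis p (he.toBasisAt hp)).linearIndependent
    rwa [funext (S.frameBasis_toBasisAt he hp)] at this
  generating {p} hp := by
    have := (S.frameBasis p (he.toBasisAt hp)).span_eq
    rw [funext (S.frameBasis_toBasisAt he hp)] at this
    exact this.ge
  contMDiffOn j := by
    have := S.smooth U hU (fun i p => if (i : ℕ) + j < k then e 0 p else e 1 p) (fun i => by
      by_cases h : (i : ℕ) + j < k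
      · simpa [h] using he.contMDiffOn 0
      · simpa [h] using he.contMDiffOn 1)
    exact this

variable [FiniteDimensional ℝ F] [VectorBundle ℝ F E] [ContMDiffVectorBundle ∞ F E (𝓡 (k + 1))]

/-- A covariant derivative on `TM` is given at `p` by a `𝔤𝔩(2)`-valued form `φ` in the adapted
frames of `e`. -/
def GL2Structure.HasFormAt (S : GL2Structure k M F E) (cov : ((q : M) → TangentSpace (𝓡 (k + 1)) q) →
      (q : M) → TangentSpace (𝓡 (k + 1)) q →L[ℝ] TangentSpace (𝓡 (k + 1)) q)
    (e : Fin 2 → (p : M) → E p) (p : M)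
    (φ : TangentSpace (𝓡 (k + 1)) p →ₗ[ℝ] Matrix (Fin 2) (Fin 2) ℝ) : Prop :=
  ∀ X j, cov (S.frameField e j) p X = ∑ i, rep k (φ X) i j • S.frameField e i p

/-- Being given by a `𝔤𝔩(2)`-valued form does not depend on the frame of `E`. -/
lemma GL2Structure.HasFormAt.exists_of_frame {cov : ((q : M) → TangentSpace (𝓡 (k + 1)) q) →
      (q : M) → TangentSpace (𝓡 (k + 1)) q →L[ℝ] TangentSpace (𝓡 (k + 1)) q}
    (hcov : IsCovariantDerivativeOn (EuclideanSpace ℝ (Fin (k + 1))) cov Set.univ)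
    (he : IsLocalFrameOn (𝓡 (k + 1)) F ∞ e U) (hU : IsOpen U) (hpU : p ∈ U)
    {φ : TangentSpace (𝓡 (k + 1)) p →ₗ[ℝ] Matrix (Fin 2) (Fin 2) ℝ} (h : S.HasFormAt cov e p φ)
    {U' : Set M} {e' : Fin 2 → (p : M) → E p}
    (he' : IsLocalFrameOn (𝓡 (k + 1)) F ∞ e' U') (hU' : IsOpen U') (hpU' : p ∈ U') :
    ∃ φ', S.HasFormAt cov e' p φ' := by
  set u := he.toBasisAt hpU with hu
  set u' := he'.toBasisAt hpU' with hu'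
  have hua : ∀ a, u a = e a p := he.toBasisAt_coe hpU
  have hua' : ∀ a, u' a = e' a p := he'.toBasisAt_coe hpU'
  -- the transition functions
  set f : Fin 2 → Fin 2 → M → ℝ := fun a b q => he.coeff b q (e' a q) with hf
  have hfd : ∀ a b, MDifferentiableAt (𝓡 (k + 1)) 𝓘(ℝ) (f a b) p := fun a b =>
    mdifferentiableAt_coeff (by simp) he (hU.mem_nhds hpU)
      (((he'.contMDiffOn a).contMDiffAt (hU'.mem_nhds hpU')).mdifferentiableAt (by simp)) b
  have hfe : ∀ q ∈ U, ∀ a, e' a q = ∑ b, f a b q • e b q := fun q hq a => he.coeff_sum_eq (e' a) hq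
  -- the covariant derivative on `E`
  let A : TangentSpace (𝓡 (k + 1)) p → E p →ₗ[ℝ] E p := fun X => Matrix.toLin u u (φ X)
  -- `D X a` is the derivative of `e' a = ∑ b, f a b • e b` for the connection on `E` whose form in
  -- `e` is `φ`; its coefficients in `e'` are the transformed form `φ'`.
  let D : TangentSpace (𝓡 (k + 1)) p →ₗ[ℝ] Fin 2 → E p :=
    { toFun := fun X a => ∑ b, mvfderiv (𝓡 (k + 1)) (f a b) p X • e b p + A X (e' a p)
      map_add' := fun X Y => by
        ext a
        simp [A, add_smul]
        abel
      map_smul' := fun c X => by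
        ext a
        simp [A, mul_smul] }
  let φ' : TangentSpace (𝓡 (k + 1)) p →ₗ[ℝ] Matrix (Fin 2) (Fin 2) ℝ :=
    { toFun := fun X => Matrix.of fun b a => u'.repr (D X a) b
      map_add' := fun X Y => by ext; simp
      map_smul' := fun c X => by ext; simp }
  refine ⟨φ', fun X j => ?_⟩
  let A' : E p →ₗ[ℝ] E p := u'.constr ℝ (D X)
  have hA' : ∀ a, A' (u' a) = D X a := fun a => u'.constr_basis ℝ _ a
  have hA'φ : ∀ a, A' (u' a) = φ' X 0 a • u' 0 + φ' X 1 a • u' 1 := by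
    intro a
    rw [hA', ← Fin.sum_univ_two (fun b => φ' X b a • u' b)]
    exact (u'.sum_repr (D X a)).symm
  have hAφ : ∀ a, A X (u a) = φ X 0 a • u 0 + φ X 1 a • u 1 := by
    intro a
    rw [← Fin.sum_univ_two (fun b => φ X b a • u b)]
    exact Matrix.toLin_self u u (φ X) a
  set T := S.prodMap p with hT
  have hTs : IsSymm T := S.isSymm_prodMap p
  let w : Fin k → Fin 2 := fun i => if (i : ℕ) + j < k then 0 else 1
  have hw : ones w = j := ones_sorted (Nat.lt_succ_iff.mp j.2)
  have hword : ∀ q, S.frameField e' j q = S.prodMap q fun i => e' (w i) q := by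
    intro q
    refine congrArg (S.prodMap q) (funext fun i => ?_)
    simp only [w]
    split_ifs <;> rfl
  have hrk : ∀ r : Fin k → Fin 2, ones r < k + 1 := fun r => Nat.lt_succ_of_le (ones_le r)
  let s : (Fin k → Fin 2) → (q : M) → TangentSpace (𝓡 (k + 1)) q := fun r =>
    S.frameField e ⟨ones r, hrk r⟩
  have hs : ∀ r q, s r q = S.prodMap q fun i => e (r i) q := fun r q =>
    ((S.isSymm_prodMap q).apply_comp (fun a => e a q) r).symm
  have hχ := S.isLocalFrameOn_frameField he hU
  have hχ' := S.isLocalFrameOn_frameField he' hU'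
  have hsd : ∀ r, MDifferentiableAt (𝓡 (k + 1)) (𝓡 (k + 1)).tangent
      (fun q => (⟨q, s r q⟩ : TangentBundle (𝓡 (k + 1)) M)) p :=
    fun r => ((hχ.contMDiffOn _).contMDiffAt (hU.mem_nhds hpU)).mdifferentiableAt (by simp)
  let P : (Fin k → Fin 2) → M → ℝ := fun r q => ∏ i, f (w i) (r i) q
  have hP : ∀ r, MDifferentiableAt (𝓡 (k + 1)) 𝓘(ℝ) (P r) p ∧ ∀ X, mvfderiv (𝓡 (k + 1)) (P r) p X = _ := fun r =>
    mdifferentiableAt_mvfderiv_prod Finset.univ (f := fun i => f (w i) (r i)) fun i => hfd _ _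
  -- Multilinearity writes the new adapted frame through words in the old frame, with products of
  -- transition functions as coefficients.
  have hexp : ∀ q ∈ U, S.frameField e' j q = ∑ r, P r q • s r q := by
    intro q hq
    rw [hword]
    simp only [hfe q hq, hs]
    exact apply_sum_smul (S.prodMap q) (fun b => e b q) (fun i b => f (w i) b q)
  have hsum : MDifferentiableAt (𝓡 (k + 1)) (𝓡 (k + 1)).tangent (fun q =>
      (⟨q, ∑ r, P r q • s r q⟩ : TangentBundle (𝓡 (k + 1)) M)) p :=
    MDifferentiableAt.sum_section fun r _ => (hP r).1.smul_section (hsd r)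
  have hfd' : MDifferentiableAt (𝓡 (k + 1)) (𝓡 (k + 1)).tangent (fun q =>
      (⟨q, S.frameField e' j q⟩ : TangentBundle (𝓡 (k + 1)) M)) p :=
    ((hχ'.contMDiffOn j).contMDiffAt (hU'.mem_nhds hpU')).mdifferentiableAt (by simp)
  rw [hcov.congr_of_eventuallyEq hfd' hsum Filter.univ_mem
    (Filter.eventually_of_mem (hU.mem_nhds hpU) hexp),
    cov_sum_smul hcov (Set.mem_univ p) _ (fun r => (hP r).1) hsd]
  have hcs : ∀ r, cov (s r) p X = der T (A X) (fun i => u (r i)) := by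
    intro r
    rw [der_word hTs hAφ r ⟨ones r, hrk r⟩ rfl, toBasisAt_funext]
    exact h X _
  have hsp : ∀ r, s r p = T (fun i => u (r i)) := by
    intro r
    simp only [hs, hua, hT]
  have hrhs : ∑ i, rep k (φ' X) i j • S.frameField e' i p = der T A' (fun i => u' (w i)) := by
    rw [der_word hTs hA'φ w j hw, toBasisAt_funext]
    rfl
  rw [hrhs, der_apply]
  simp only [hcs, hsp, hA']
  set v : Fin k → E p := fun i => u' (w i) with hv
  have hvf : v = fun i => ∑ b, f (w i) b p • u b := by
    funext i
    simp only [hv, hua', hua]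
    exact hfe p hpU _
  have hD : ∀ i, D X (w i) = ∑ b, mvfderiv (𝓡 (k + 1)) (f (w i) b) p X • u b + A X (v i) := by
    intro i
    simp only [hv, hua', hua]
    rfl
  simp only [hD, MultilinearMap.map_update_add, Finset.sum_add_distrib]
  -- The Leibniz rule leaves two matching parts: the derivation by `A X`, and the derivatives of the
  -- coefficient products, which agree after interchanging the sums over words and positions.
  rw [← der_apply T (A X) v, add_comm (∑ i, T _)]
  congr 1
  · rw [hvf, apply_sum_smul]
  · have hterm : ∀ i, T (Function.update v i (∑ b, mvfderiv (𝓡 (k + 1)) (f (w i) b) p X • u b)) =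
        ∑ r : Fin k → Fin 2, (mvfderiv (𝓡 (k + 1)) (f (w i) (r i)) p X *
          ∏ l ∈ Finset.univ.erase i, f (w l) (r l) p) • T (fun i => u (r i)) := by
      intro i
      have : Function.update v i (∑ b, mvfderiv (𝓡 (k + 1)) (f (w i) b) p X • u b) = fun l => ∑ b,
          Function.update (fun l b => f (w l) b p) i (fun b => mvfderiv (𝓡 (k + 1)) (f (w i) b) p X) l b •
            u b := by
        funext l
        by_cases hl : l = i
        · subst hl; simp
        · simp [hl, hvf]
      rw [this, apply_sum_smul]
      refine Finset.sum_congr rfl fun r _ => ?_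
      rw [← Finset.mul_prod_erase Finset.univ _ (Finset.mem_univ i), Function.update_self]
      congr 2
      refine Finset.prod_congr rfl fun l hl => ?_
      rw [Function.update_of_ne (Finset.ne_of_mem_erase hl)]
    simp only [hterm]
    rw [Finset.sum_comm]
    refine Finset.sum_congr rfl fun r _ => ?_
    rw [(hP r).2 X, Finset.sum_smul]

end Structure

/-! ### Torsion in adapted frames and the local solution. -/

section Normalization

variable {k : ℕ} {M : Type*} [TopologicalSpace M]
  [ChartedSpace (EuclideanSpace ℝ (Fin (k + 1))) M] [IsManifold (𝓡 (k + 1)) ∞ M]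
  {F : Type*} [NormedAddCommGroup F] [NormedSpace ℝ F]
  {E : M → Type*} [TopologicalSpace (TotalSpace F E)]
  [∀ p, AddCommGroup (E p)] [∀ p, Module ℝ (E p)] [∀ p, TopologicalSpace (E p)]
  [FiberBundle F E] (S : GL2Structure k M F E) {p : M}

/-- The endomorphisms `Θ X` have matrices in `𝔤_k^⊥` in the adapted frame of `u`. -/
def GL2Structure.NormalizedIn (S : GL2Structure k M F E) {p : M}
    (Θ : TangentSpace (𝓡 (k + 1)) p →L[ℝ] TangentSpace (𝓡 (k + 1)) p →L[ℝ]
      TangentSpace (𝓡 (k + 1)) p) (u : Module.Basis (Fin 2) ℝ (E p)) : Prop :=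
  ∀ X, LinearMap.toMatrix (S.frameBasis p u) (S.frameBasis p u) (Θ X).toLinearMap ∈ gkPerp k

variable {S}

/-- The frame-free criterion `toMatrix_mem_gkPerp_iff` serves as the bridge, so checking one adapted
frame per point suffices. -/
lemma GL2Structure.NormalizedIn.of_basis {Θ : TangentSpace (𝓡 (k + 1)) p →L[ℝ]
      TangentSpace (𝓡 (k + 1)) p →L[ℝ] TangentSpace (𝓡 (k + 1)) p}
    {u : Module.Basis (Fin 2) ℝ (E p)} (h : S.NormalizedIn Θ u)
    (u' : Module.Basis (Fin 2) ℝ (E p)) : S.NormalizedIn Θ u' := fun X =>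
  (toMatrix_mem_gkPerp_iff (S.isSymm_prodMap p) (S.span_prodMap p) (finrank_tangentSpace p) u'
    _).2 ((toMatrix_mem_gkPerp_iff (S.isSymm_prodMap p) (S.span_prodMap p)
      (finrank_tangentSpace p) u _).1 (h X))

lemma GL2Structure.hasNormalizedTorsion_iff {cov : CovariantDerivative (𝓡 (k + 1))
      (EuclideanSpace ℝ (Fin (k + 1))) (TangentSpace (𝓡 (k + 1)) : M → Type _)} :
    S.HasNormalizedTorsion cov ↔
      ∀ (p : M) (u : Module.Basis (Fin 2) ℝ (E p)), S.NormalizedIn (cov.torsion p) u := by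
  refine forall_congr' fun p => forall_congr' fun u => forall_congr' fun X => ⟨?_, fun h => ?_⟩
  · rintro ⟨ψ, hψ, h⟩
    have : LinearMap.toMatrix (S.frameBasis p u) (S.frameBasis p u)
        (cov.torsion p X).toLinearMap = ψ := by
      rw [← LinearMap.toMatrix_toLin (S.frameBasis p u) (S.frameBasis p u) ψ]
      congr 1
      refine (S.frameBasis p u).ext fun j => ?_
      rw [Matrix.toLin_self]
      simpa using h j
    rwa [this]
  · refine ⟨_, h, fun j => ?_⟩
    have := Matrix.toLin_self (S.frameBasis p u) (S.frameBasis p u)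
      (LinearMap.toMatrix (S.frameBasis p u) (S.frameBasis p u) (cov.torsion p X).toLinearMap) j
    rw [Matrix.toLin_toMatrix] at this
    simpa using this

/-- The structure functions of a frame of vector fields. -/
def structureCoeff {U : Set M} {χ : Fin (k + 1) → (p : M) → TangentSpace (𝓡 (k + 1)) p}
    (hχ : IsLocalFrameOn (𝓡 (k + 1)) (EuclideanSpace ℝ (Fin (k + 1))) ∞ χ U) (p : M)
    (l : Fin (k + 1)) : Matrix (Fin (k + 1)) (Fin (k + 1)) ℝ :=
  Matrix.of fun i j => hχ.coeff i p (VectorField.mlieBracket (𝓡 (k + 1)) (χ l) (χ j) p)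

lemma contMDiffAt_structureCoeff {U : Set M}
    {χ : Fin (k + 1) → (p : M) → TangentSpace (𝓡 (k + 1)) p}
    (hχ : IsLocalFrameOn (𝓡 (k + 1)) (EuclideanSpace ℝ (Fin (k + 1))) ∞ χ U) (hU : U ∈ nhds p)
    (l i j : Fin (k + 1)) :
    ContMDiffAt (𝓡 (k + 1)) 𝓘(ℝ) ∞ (fun q => structureCoeff hχ q l i j) p := by
  have : IsManifold (𝓡 (k + 1)) (minSmoothness ℝ 2) M := by
    rw [minSmoothness_of_isRCLikeNormedField]
    infer_instance
  have : IsManifold (𝓡 (k + 1)) (((⊤ : ℕ∞) : ℕ∞ω) + 1) M := ‹IsManifold (𝓡 (k + 1)) ∞ M›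
  exact contMDiffAt_coeff hχ hU (ContMDiffAt.mlieBracket_vectorField (m := ⊤) (n := ⊤)
    ((hχ.contMDiffOn l).contMDiffAt hU) ((hχ.contMDiffOn j).contMDiffAt hU)
    (by rw [minSmoothness_of_isRCLikeNormedField]; rfl)) i

variable {U : Set M} {e : Fin 2 → (p : M) → E p}
  {cov : CovariantDerivative (𝓡 (k + 1)) (EuclideanSpace ℝ (Fin (k + 1)))
    (TangentSpace (𝓡 (k + 1)) : M → Type _)}

/-- This is `∇_X Y - ∇_Y X - [X, Y]` evaluated on two frame fields. -/
lemma GL2Structure.HasFormAt.toMatrix_torsion (he : IsLocalFrameOn (𝓡 (k + 1)) F ∞ e U)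
    (hU : IsOpen U) (hp : p ∈ U)
    {φ : TangentSpace (𝓡 (k + 1)) p →ₗ[ℝ] Matrix (Fin 2) (Fin 2) ℝ} (h : S.HasFormAt cov e p φ)
    (l : Fin (k + 1)) :
    LinearMap.toMatrix (S.frameBasis p (he.toBasisAt hp)) (S.frameBasis p (he.toBasisAt hp))
      (cov.torsion p (S.frameField e l p)).toLinearMap =
      torsionPart (fun m => φ (S.frameField e m p)) l -
        structureCoeff (S.isLocalFrameOn_frameField he hU) p l := by
  set χ := S.frameBasis p (he.toBasisAt hp)
  have hχ := S.isLocalFrameOn_frameField he hU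
  have hd : ∀ j, MDifferentiableAt (𝓡 (k + 1)) (𝓡 (k + 1)).tangent
      (fun q => (⟨q, S.frameField e j q⟩ : TangentBundle (𝓡 (k + 1)) M)) p := fun j =>
    ((hχ.contMDiffOn j).contMDiffAt (hU.mem_nhds hp)).mdifferentiableAt (by simp)
  rw [← LinearMap.toMatrix_toLin χ χ (_ - _)]
  congr 1
  refine χ.ext fun j => ?_
  rw [Matrix.toLin_self]
  simp only [χ, S.frameBasis_toBasisAt he hp]
  refine (cov.torsion_apply (hd l) (hd j)).trans ?_
  rw [h, h, hχ.coeff_sum_eq (VectorField.mlieBracket (𝓡 (k + 1)) _ _) hp,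
    ← Finset.sum_sub_distrib, ← Finset.sum_sub_distrib]
  refine Finset.sum_congr rfl fun i _ => ?_
  simp [torsionPart, structureCoeff, sub_smul]

lemma GL2Structure.HasFormAt.normalizedIn_iff (he : IsLocalFrameOn (𝓡 (k + 1)) F ∞ e U)
    (hU : IsOpen U) (hp : p ∈ U)
    {φ : TangentSpace (𝓡 (k + 1)) p →ₗ[ℝ] Matrix (Fin 2) (Fin 2) ℝ}
    (h : S.HasFormAt cov e p φ) :
    S.NormalizedIn (cov.torsion p) (he.toBasisAt hp) ↔
      ∀ l, torsionPart (fun m => φ (S.frameField e m p)) l -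
        structureCoeff (S.isLocalFrameOn_frameField he hU) p l ∈ gkPerp k := by
  refine ⟨fun hn l => ?_, fun hn X => ?_⟩
  · rw [← h.toMatrix_torsion he hU hp]
    exact hn _
  · have hX := (S.frameBasis p (he.toBasisAt hp)).sum_repr X
    simp only [S.frameBasis_toBasisAt he hp] at hX
    have : (cov.torsion p X).toLinearMap = ∑ l, (S.frameBasis p (he.toBasisAt hp)).repr X l •
        (cov.torsion p (S.frameField e l p)).toLinearMap := by
      conv_lhs => rw [← hX]
      ext Y
      simp
    rw [this, map_sum]
    refine Submodule.sum_mem _ fun l _ => ?_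
    rw [map_smul, h.toMatrix_torsion he hU hp]
    exact Submodule.smul_mem _ _ (hn l)

variable (S)

/-- The connection that is given in the adapted frames of `e` by the `𝔤𝔩(2)`-valued form with
values `s C`, for `C` the structure functions. -/
def GL2Structure.localCov (s : (Fin (k + 1) → Matrix (Fin (k + 1)) (Fin (k + 1)) ℝ) →ₗ[ℝ]
      (Fin (k + 1) → Matrix (Fin 2) (Fin 2) ℝ)) (he : IsLocalFrameOn (𝓡 (k + 1)) F ∞ e U)
    (hU : IsOpen U) :
    ((q : M) → TangentSpace (𝓡 (k + 1)) q) →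
      (q : M) → TangentSpace (𝓡 (k + 1)) q →L[ℝ] TangentSpace (𝓡 (k + 1)) q :=
  frameCov (S.isLocalFrameOn_frameField he hU) fun q m =>
    rep k (s (structureCoeff (S.isLocalFrameOn_frameField he hU) q) m)

variable {s : (Fin (k + 1) → Matrix (Fin (k + 1)) (Fin (k + 1)) ℝ) →ₗ[ℝ]
      (Fin (k + 1) → Matrix (Fin 2) (Fin 2) ℝ)}

variable {S}

lemma GL2Structure.localCov_frameField (he : IsLocalFrameOn (𝓡 (k + 1)) F ∞ e U) (hU : IsOpen U)
    (hp : p ∈ U) {φ : TangentSpace (𝓡 (k + 1)) p →ₗ[ℝ] Matrix (Fin 2) (Fin 2) ℝ}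
    (hφ : ∀ m, φ (S.frameField e m p) =
      s (structureCoeff (S.isLocalFrameOn_frameField he hU) p) m) :
    S.HasFormAt (S.localCov s he hU) e p φ := by
  intro X j
  refine (frameCov_frame _ _ (hU.mem_nhds hp) j X).trans ?_
  refine Finset.sum_congr rfl fun i _ => ?_
  congr 1
  have hχ := S.isLocalFrameOn_frameField he hU
  have hX : X = ∑ m, hχ.coeff m p X • S.frameField e m p := by
    simpa [IsLocalFrameOn.coeff, hp] using ((hχ.toBasisAt hp).sum_repr X).symm
  conv_rhs => rw [hX]
  simp [hφ, Matrix.sum_apply]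

/-- Pointwise uniqueness: `φ` and `s C` solve the same linear system at `p`, so their difference is
killed by `torsionPart_injective`. It serves both for gluing and for the final uniqueness. -/
lemma GL2Structure.HasFormAt.eq_localCov (hk : 3 ≤ k)
    (hs : ∀ c l, torsionPart (s c) l - c l ∈ gkPerp k)
    (he : IsLocalFrameOn (𝓡 (k + 1)) F ∞ e U) (hU : IsOpen U) (hp : p ∈ U)
    {φ : TangentSpace (𝓡 (k + 1)) p →ₗ[ℝ] Matrix (Fin 2) (Fin 2) ℝ}
    (h : S.HasFormAt cov e p φ) (hn : S.NormalizedIn (cov.torsion p) (he.toBasisAt hp))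
    {Y : (q : M) → TangentSpace (𝓡 (k + 1)) q}
    (hY : MDifferentiableAt (𝓡 (k + 1)) (𝓡 (k + 1)).tangent
      (fun q => (⟨q, Y q⟩ : TangentBundle (𝓡 (k + 1)) M)) p) :
    cov Y p = S.localCov s he hU Y p := by
  have hχ := S.isLocalFrameOn_frameField he hU
  set C := structureCoeff hχ p with hC
  have hφ : (fun m => φ (S.frameField e m p)) - s C = 0 := by
    refine torsionPart_injective hk _ fun l => ?_
    have h1 := Submodule.sub_mem _ ((h.normalizedIn_iff he hU hp).1 hn l) (hs C l)
    rw [sub_sub_sub_cancel_right] at h1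
    rwa [sub_eq_add_neg, ← neg_one_smul ℝ (s C), torsionPart_add, torsionPart_smul, neg_one_smul,
      ← sub_eq_add_neg]
  have hφ' := S.localCov_frameField he hU hp (s := s) (φ := φ) fun m =>
    sub_eq_zero.1 (congrFun hφ m)
  refine cov_eq_of_frame (cov.isCovariantDerivativeOn (s := U))
    (isCovariantDerivativeOn_frameCov hχ _ hU) (hU.mem_nhds hp) hχ (fun j => ?_) hY
  ext1 X
  exact (h X j).trans (hφ' X j).symm

lemma GL2Structure.contMDiffAt_localCov (he : IsLocalFrameOn (𝓡 (k + 1)) F ∞ e U)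
    (hU : IsOpen U) (hp : p ∈ U) {Y : (q : M) → TangentSpace (𝓡 (k + 1)) q}
    (hY : ContMDiffAt (𝓡 (k + 1)) (𝓡 (k + 1)).tangent ∞
      (fun q => (⟨q, Y q⟩ : TangentBundle (𝓡 (k + 1)) M)) p) :
    ContMDiffAt (𝓡 (k + 1)) ((𝓡 (k + 1)).prod
        𝓘(ℝ, EuclideanSpace ℝ (Fin (k + 1)) →L[ℝ] EuclideanSpace ℝ (Fin (k + 1)))) ∞
      (fun q => (⟨q, S.localCov s he hU Y q⟩ :
        TotalSpace (EuclideanSpace ℝ (Fin (k + 1)) →L[ℝ] EuclideanSpace ℝ (Fin (k + 1)))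
        fun q : M => TangentSpace (𝓡 (k + 1)) q →L[ℝ] TangentSpace (𝓡 (k + 1)) q)) p := by
  have hχ := S.isLocalFrameOn_frameField he hU
  refine contMDiffAt_frameCov hχ _ (hU.mem_nhds hp) (fun m i j => ?_) hY
  -- The connection coefficients are one fixed linear function of the structure functions, hence
  -- smooth; this is why `s` was produced as a linear map.
  let L : (Fin (k + 1) → Fin (k + 1) → Fin (k + 1) → ℝ) →ₗ[ℝ] ℝ :=
    { toFun := fun c => rep k (s (fun l => Matrix.of (c l)) m) i j
      map_add' := fun c c' => by
        have : (fun l => Matrix.of ((c + c') l)) =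
          (fun l => Matrix.of (c l)) + fun l => Matrix.of (c' l) := rfl
        rw [this, map_add, Pi.add_apply, map_add, Matrix.add_apply]
      map_smul' := fun a c => by
        have : (fun l => Matrix.of ((a • c) l)) = a • fun l => Matrix.of (c l) := rfl
        rw [this, map_smul, Pi.smul_apply, map_smul, Matrix.smul_apply, RingHom.id_apply] }
  have hL : ContMDiff 𝓘(ℝ, Fin (k + 1) → Fin (k + 1) → Fin (k + 1) → ℝ) 𝓘(ℝ) ∞ L :=
    (LinearMap.toContinuousLinearMap L).contDiff.contMDiff
  refine hL.contMDiffAt.comp p (f := fun q l i j => structureCoeff hχ q l i j) ?_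
  refine contMDiffAt_pi_space.2 fun l => contMDiffAt_pi_space.2 fun i => contMDiffAt_pi_space.2
    fun j => contMDiffAt_structureCoeff hχ (hU.mem_nhds hp) l i j

end Normalization

/-! ### Gluing and uniqueness. -/

section Global

variable {k : ℕ} {M : Type*} [TopologicalSpace M]
  [ChartedSpace (EuclideanSpace ℝ (Fin (k + 1))) M] [IsManifold (𝓡 (k + 1)) ∞ M]
  {F : Type*} [NormedAddCommGroup F] [NormedSpace ℝ F]
  {E : M → Type*} [TopologicalSpace (TotalSpace F E)]
  [∀ p, AddCommGroup (E p)] [∀ p, Module ℝ (E p)] [∀ p, TopologicalSpace (E p)]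
  [FiberBundle F E] (S : GL2Structure k M F E)
  {U : M → Set M} {e : M → Fin 2 → (q : M) → E q}
  (s : (Fin (k + 1) → Matrix (Fin (k + 1)) (Fin (k + 1)) ℝ) →ₗ[ℝ]
    (Fin (k + 1) → Matrix (Fin 2) (Fin 2) ℝ))
  (he : ∀ p, IsLocalFrameOn (𝓡 (k + 1)) F ∞ (e p) (U p)) (hU : ∀ p, IsOpen (U p))
  (hpU : ∀ p, p ∈ U p)

/-- The connection that agrees at `p` with the local connection of the frame `e p`. -/
def GL2Structure.globalCov : CovariantDerivative (𝓡 (k + 1)) (EuclideanSpace ℝ (Fin (k + 1)))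
    (TangentSpace (𝓡 (k + 1)) : M → Type _) where
  toFun Y p := S.localCov s (he p) (hU p) Y p
  isCovariantDerivativeOnUniv :=
    -- Additivity and the Leibniz rule compare values at a single point `p`, where the frame `e p`
    -- is held fixed; no compatibility between different points is needed.
    { add := fun {_ _ p} hY hZ _ => frameCov_add _ _ ((hU p).mem_nhds (hpU p)) hY hZ
      leibniz := fun {_ _ p} hY hf _ => frameCov_smul _ _ ((hU p).mem_nhds (hpU p)) hY hf }

variable {S s}

lemma GL2Structure.exists_hasFormAt_globalCov (hs : ∀ c l, torsionPart (s c) l - c l ∈ gkPerp k)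
    (p : M) : ∃ φ, S.HasFormAt (S.globalCov s he hU hpU) (e p) p φ ∧
      S.NormalizedIn ((S.globalCov s he hU hpU).torsion p) ((he p).toBasisAt (hpU p)) := by
  have hχ := S.isLocalFrameOn_frameField (he p) (hU p)
  let φ := (S.frameBasis p ((he p).toBasisAt (hpU p))).constr ℝ (s (structureCoeff hχ p))
  have hφ : ∀ m, φ (S.frameField (e p) m p) = s (structureCoeff hχ p) m := fun m => by
    rw [← S.frameBasis_toBasisAt (he p) (hpU p)]
    exact Module.Basis.constr_basis ..
  have h : S.HasFormAt (S.globalCov s he hU hpU) (e p) p φ := by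
    intro X j
    change S.localCov s (he p) (hU p) (S.frameField (e p) j) p X = _
    exact S.localCov_frameField (he p) (hU p) (hpU p) hφ X j
  refine ⟨φ, h, (h.normalizedIn_iff (he p) (hU p) (hpU p)).2 fun l => ?_⟩
  rw [funext hφ]
  exact hs _ l

lemma GL2Structure.hasNormalizedTorsion_globalCov
    (hs : ∀ c l, torsionPart (s c) l - c l ∈ gkPerp k) :
    S.HasNormalizedTorsion (S.globalCov s he hU hpU) :=
  hasNormalizedTorsion_iff.2 fun p u => by
    obtain ⟨φ, -, h⟩ := exists_hasFormAt_globalCov he hU hpU hs p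
    exact h.of_basis u

variable [FiniteDimensional ℝ F] [VectorBundle ℝ F E] [ContMDiffVectorBundle ∞ F E (𝓡 (k + 1))]

lemma GL2Structure.exists_hasFormAt_globalCov_of_frame
    (hs : ∀ c l, torsionPart (s c) l - c l ∈ gkPerp k) {V : Set M} (hV : IsOpen V)
    {e' : Fin 2 → (p : M) → E p} (he' : IsLocalFrameOn (𝓡 (k + 1)) F ∞ e' V) (p : M)
    (hp : p ∈ V) : ∃ φ, S.HasFormAt (S.globalCov s he hU hpU) e' p φ := by
  obtain ⟨φ, h, -⟩ := exists_hasFormAt_globalCov (S := S) he hU hpU hs p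
  exact HasFormAt.exists_of_frame S (S.globalCov s he hU hpU).isCovariantDerivativeOn (he p) (hU p)
    (hpU p) h he' hV hp

/-- The frame used at `p` may be replaced by the one attached to `q`: at `p` the connection has a
form in that frame too and stays normalized, so pointwise uniqueness applies. On `U q` the choice
thus becomes a single smooth formula. -/
lemma GL2Structure.globalCov_eq_localCov (hk : 3 ≤ k)
    (hs : ∀ c l, torsionPart (s c) l - c l ∈ gkPerp k) {p q : M} (hp : p ∈ U q)
    {Y : (q : M) → TangentSpace (𝓡 (k + 1)) q}
    (hY : MDifferentiableAt (𝓡 (k + 1)) (𝓡 (k + 1)).tangent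
      (fun q => (⟨q, Y q⟩ : TangentBundle (𝓡 (k + 1)) M)) p) :
    S.globalCov s he hU hpU Y p = S.localCov s (he q) (hU q) Y p := by
  obtain ⟨φ, h⟩ := exists_hasFormAt_globalCov_of_frame (S := S) he hU hpU hs (hU q) (he q) p hp
  exact h.eq_localCov hk hs (he q) (hU q) hp
    (hasNormalizedTorsion_iff.1 (hasNormalizedTorsion_globalCov he hU hpU hs) p _) hY

lemma GL2Structure.contMDiffCovariantDerivative_globalCov (hk : 3 ≤ k)
    (hs : ∀ c l, torsionPart (s c) l - c l ∈ gkPerp k) :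
    CovariantDerivative.ContMDiffCovariantDerivative (S.globalCov s he hU hpU) ∞ := by
  refine ⟨⟨fun {Y} hY q _ => ?_⟩⟩
  have hY' : ∀ p, ContMDiffAt (𝓡 (k + 1)) (𝓡 (k + 1)).tangent ∞
      (fun q => (⟨q, Y q⟩ : TangentBundle (𝓡 (k + 1)) M)) p := fun p =>
    hY.contMDiffAt Filter.univ_mem
  refine ContMDiffAt.contMDiffWithinAt ?_
  refine (contMDiffAt_localCov (S := S) (s := s) (he q) (hU q) (hpU q)
    (hY' q)).congr_of_eventuallyEq ?_
  filter_upwards [(hU q).mem_nhds (hpU q)] with p hp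
  exact congrArg (TotalSpace.mk p) (globalCov_eq_localCov he hU hpU hk hs hp
    ((hY' p).mdifferentiableAt (by simp)))

lemma GL2Structure.isGL2Connection_globalCov (hk : 3 ≤ k)
    (hs : ∀ c l, torsionPart (s c) l - c l ∈ gkPerp k) :
    S.IsGL2Connection (S.globalCov s he hU hpU) where
  smooth := contMDiffCovariantDerivative_globalCov he hU hpU hk hs
  adapted V hV e' he' := by
    classical
    choose! φ hφ using exists_hasFormAt_globalCov_of_frame (S := S) he hU hpU hs hV he'
    exact ⟨φ, hφ⟩

omit [FiniteDimensional ℝ F] [VectorBundle ℝ F E] [ContMDiffVectorBundle ∞ F E (𝓡 (k + 1))] in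
lemma GL2Structure.IsGL2Connection.eq_globalCov (hk : 3 ≤ k)
    (hs : ∀ c l, torsionPart (s c) l - c l ∈ gkPerp k)
    {cov : CovariantDerivative (𝓡 (k + 1)) (EuclideanSpace ℝ (Fin (k + 1)))
      (TangentSpace (𝓡 (k + 1)) : M → Type _)} (h : S.IsGL2Connection cov)
    (hn : S.HasNormalizedTorsion cov) {Y : (p : M) → TangentSpace (𝓡 (k + 1)) p} {p : M}
    (hY : MDifferentiableAt (𝓡 (k + 1)) (𝓡 (k + 1)).tangent
      (fun q => (⟨q, Y q⟩ : TangentBundle (𝓡 (k + 1)) M)) p) :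
    cov Y p = S.globalCov s he hU hpU Y p := by
  obtain ⟨φ, hφ⟩ := h.adapted (U p) (hU p) (e p) (he p)
  have h' : S.HasFormAt cov (e p) p (φ p) := hφ p (hpU p)
  exact h'.eq_localCov hk hs (he p) (hU p) (hpU p) (hasNormalizedTorsion_iff.1 hn p _) hY

end Global

end GL2

end

/-! ### The main theorem, with frames of `E` taken from its trivializations. -/

theorem theorem3 (k : ℕ) (hk : 3 < k + 1)
    (M : Type*) [TopologicalSpace M] [T2Space M] [SecondCountableTopology M]
    [ChartedSpace (EuclideanSpace ℝ (Fin (k + 1))) M] [IsManifold (𝓡 (k + 1)) ∞ M]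
    (F : Type*) [NormedAddCommGroup F] [NormedSpace ℝ F] (hF : Module.finrank ℝ F = 2)
    (E : M → Type*) [TopologicalSpace (TotalSpace F E)]
    [∀ p, AddCommGroup (E p)] [∀ p, Module ℝ (E p)] [∀ p, TopologicalSpace (E p)]
    [FiberBundle F E] [VectorBundle ℝ F E] [ContMDiffVectorBundle ∞ F E (𝓡 (k + 1))]
    (S : GL2.GL2Structure k M F E) :
    ∃ cov : CovariantDerivative (𝓡 (k + 1)) (EuclideanSpace ℝ (Fin (k + 1)))
        (TangentSpace (𝓡 (k + 1)) : M → Type _),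
      S.IsGL2Connection cov ∧ S.HasNormalizedTorsion cov ∧
      -- uniqueness: any other such connection agrees with `cov` on every vector field `Y`, at every
      -- point at which `Y` is differentiable
      ∀ cov' : CovariantDerivative (𝓡 (k + 1)) (EuclideanSpace ℝ (Fin (k + 1)))
          (TangentSpace (𝓡 (k + 1)) : M → Type _),
        S.IsGL2Connection cov' → S.HasNormalizedTorsion cov' →
        ∀ (Y : (p : M) → TangentSpace (𝓡 (k + 1)) p) (p : M),
          MDifferentiableAt (𝓡 (k + 1)) (𝓡 (k + 1)).tangent
            (fun q => (⟨q, Y q⟩ : TangentBundle (𝓡 (k + 1)) M)) p → cov' Y p = cov Y p := by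
  have hk3 : 3 ≤ k := Nat.lt_succ_iff.1 hk
  have : FiniteDimensional ℝ F := Module.finite_of_finrank_pos (by omega)
  let b : Module.Basis (Fin 2) ℝ F := Module.finBasisOfFinrankEq ℝ F hF
  obtain ⟨s, hs⟩ := GL2.exists_normalizing hk3
  have hU : ∀ p, IsOpen (trivializationAt F E p).baseSet := fun p =>
    (trivializationAt F E p).open_baseSet
  have hpU : ∀ p, p ∈ (trivializationAt F E p).baseSet := fun p =>
    FiberBundle.mem_baseSet_trivializationAt F E p
  have he : ∀ p, IsLocalFrameOn (𝓡 (k + 1)) F ∞ ((trivializationAt F E p).localFrame b)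
      (trivializationAt F E p).baseSet := fun p =>
    (trivializationAt F E p).isLocalFrameOn_localFrame_baseSet (𝓡 (k + 1)) ∞ b
  exact ⟨S.globalCov s he hU hpU, GL2.GL2Structure.isGL2Connection_globalCov he hU hpU hk3 hs,
    GL2.GL2Structure.hasNormalizedTorsion_globalCov he hU hpU hs,
    fun cov' h1 h2 Y p hY => h1.eq_globalCov he hU hpU hk3 hs h2 hY⟩
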